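/- Let $\mathfrak H$ be a separable complex Hilbert space and let $Q$ be a bounded nonnegative selfadjoint operator in $\mathfrak H$ with $\ker Q=\{0\}$ and $\operatorname{ran}Q\neq\mathfrak H$ (so $\mathfrak H$ is infinite-dimensional). Let $\mathfrak M\subsetneq\mathfrak H$ be a proper closed subspace with $\mathfrak M^{\perp}\cap\operatorname{ran}Q=\{0\}$, and let $P_{\mathfrak M}$ be the orthogonal projection onto $\mathfrak M$. Conventions. An operator $A$ is accretive if $\operatorname{Re}(Au,u)\ge 0$ for all $u\in\operatorname{dom}A$; it is $m$-accretive if moreover it is densely defined and $\operatorname{ran}(A-\mu I)=\mathfrak H$ for some $\mu$ with $\operatorname{Re}\mu<0$. It is $m$-$\alpha$-sectorial ($0\le\alpha<\pi/2$) if it is $m$-accretive and its numerical range $\{(Au,u):u\in\operatorname{dom}A,\ \|u\|=1\}$ lies in the sector $\{z:|\arg z|\le\alpha\}$. For a bounded accretive operator $A$ and $\gamma\in(0,1)$, $$A^{\gamma}=\frac{\sin(\gamma\pi)}{\pi}\int_0^\infty t^{\gamma-1}A(A+tI)^{-1}\,dt,$$ and for an $m$-accretive operator $A$, $A^{\gamma}=(I-T)^{\gamma}\big((I+T)^{\gamma}\big)^{-1}$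 with $T=(I-A)(I+A)^{-1}$; we write $A^{*\gamma}=(A^*)^\gamma$. Then there is a bounded operator $Z_0$ (clearly unique, because $\ker Q=\{0\}$) with $QZ_0=i\,(QP_{\mathfrak M}Q)^{1/2}$, that is, $Z_0=iQ^{-1}(QP_{\mathfrak M}Q)^{1/2}$, and it is a contraction. Let $\gamma\in(0,1)$. The operator $(I+Z_0)^\gamma+(I-Z_0)^\gamma$ has a bounded inverse. Put $$Z_\gamma^{(0)}=\big((I+Z_0)^\gamma-(I-Z_0)^\gamma\big)\big((I+Z_0)^\gamma+(I-Z_0)^\gamma\big)^{-1},$$ $$Z_\gamma^{(0)}(t)=Z_\gamma^{(0)}\exp\!\big(-t(I-(Z_\gamma^{(0)})^2)\big),\qquad t\ge 0.$$ For all integers $n\ge 0$ and all $t\ge 0$ the bounded operators inverted below are injective; put $$B_{\gamma,n}=\Big(Q\big(I+(Z_\gamma^{(0)})^{2n+1}\big)\big(I-(Z_\gamma^{(0)})^{*(2n+1)}\big)Q\Big)^{-1},$$ $$S_\gamma(t)=\Big(Q\big(I+Z_\gamma^{(0)}(t)\big)\big(I-Z_\gamma^{(0)}(t)^*\big)Q\Big)^{-1}.$$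 1. For every $n\ge 0$ and $t\ge0$ the operators $B_{\gamma,n}$ and $S_\gamma(t)$ are unbounded and $m$-$\frac{\pi\gamma}{2}$-sectorial. 2. The function $t\mapsto S_\gamma(t)$ is norm-resolvent continuous on $[0,\infty)$: for every $t_0\ge 0$ and $\zeta\in\rho(S_\gamma(t_0))$ one has $\zeta\in\rho(S_\gamma(t))$ for all $t\ge0$ close to $t_0$, and $(S_\gamma(t)-\zeta I)^{-1}\to(S_\gamma(t_0)-\zeta I)^{-1}$ in operator norm as $t\to t_0$. 3. For every $n\ge0$ and $t\ge0$, $$\operatorname{dom}B_{\gamma,n}^{1/2}\neq\operatorname{dom}B_{\gamma,n}^{*1/2},\qquad \operatorname{dom}S_\gamma(t)^{1/2}\neq\operatorname{dom}S_\gamma(t)^{*1/2}.$$ 4. If in addition $\mathfrak M\cap\operatorname{ran}Q=\{0\}$, then for every $n\ge0$ and $t\ge0$, $$\operatorname{dom}B_{\gamma,n}\cap\operatorname{dom}B_{\gamma,n}^{*}=\{0\},\qquad \operatorname{dom}S_\gamma(t)\cap\operatorname{dom}S_\gamma(t)^{*}=\{0\}.$$ -/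

import Mathlib

open scoped InnerProductSpace Topology LinearPMap

namespace KatoRoot

noncomputable section

variable {H : Type*} [NormedAddCommGroup H] [InnerProductSpace ℂ H]

/-! ### Unbounded operators: accretive, sectorial, resolvents -/

/-- The numerical range `W(A) = {(Au, u) : u ∈ dom A, ‖u‖ = 1}`.  (Mathlib's inner product is linear
in the second variable, so `(Au, u)` is written `⟪u, A u⟫`.) -/
def numericalRange (A : H →ₗ.[ℂ] H) : Set ℂ :=
  {z | ∃ u : A.domain, ‖(u : H)‖ = 1 ∧ z = ⟪(u : H), A u⟫_ℂ}

/-- `A` is accretive: its numerical range lies in the closed right half-plane. -/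
def IsAccretive (A : H →ₗ.[ℂ] H) : Prop :=
  ∀ z ∈ numericalRange A, 0 ≤ z.re

/-- `A` is `m`-accretive: accretive, densely defined, and `ran (A - μ I)` is the whole space for some
`μ` with `Re μ < 0`. -/
def IsMAccretive (A : H →ₗ.[ℂ] H) : Prop :=
  IsAccretive A ∧ Dense (A.domain : Set H) ∧
    ∃ μ : ℂ, μ.re < 0 ∧ ∀ y : H, ∃ u : A.domain, A u - μ • (u : H) = y

/-- `A` is sectorial with vertex `0` and semi-angle `α ∈ [0, π/2)`. -/
def IsSectorial (α : ℝ) (A : H →ₗ.[ℂ] H) : Prop :=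
  0 ≤ α ∧ α < Real.pi / 2 ∧ ∀ z ∈ numericalRange A, |z.arg| ≤ α

/-- `A` is `m`-`α`-sectorial. -/
def IsMSectorial (α : ℝ) (A : H →ₗ.[ℂ] H) : Prop :=
  IsSectorial α A ∧ IsMAccretive A

/-- `A` is a bounded operator on its domain. -/
def IsBoundedOp (A : H →ₗ.[ℂ] H) : Prop :=
  ∃ C : ℝ, ∀ u : A.domain, ‖A u‖ ≤ C * ‖(u : H)‖

/-- The bounded operator `R` is the resolvent `(A - ζ I)⁻¹`; in particular `ζ ∈ ρ(A)`. -/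
def IsResolventAt (A : H →ₗ.[ℂ] H) (ζ : ℂ) (R : H →L[ℂ] H) : Prop :=
  (∀ y : H, ∃ u : A.domain, (u : H) = R y ∧ A u - ζ • (u : H) = y) ∧
    ∀ u : A.domain, R (A u - ζ • (u : H)) = u

/-- The resolvent set `ρ(A)`. -/
def resolventSet (A : H →ₗ.[ℂ] H) : Set ℂ := {ζ | ∃ R, IsResolventAt A ζ R}

open Classical in
/-- The resolvent `(A - ζ I)⁻¹` for `ζ ∈ ρ(A)`, and `0` for `ζ ∉ ρ(A)`. -/
def resolventOp (A : H →ₗ.[ℂ] H) (ζ : ℂ) : H →L[ℂ] H :=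
  if h : ∃ R, IsResolventAt A ζ R then h.choose else 0

/-- The operator-valued function `t ↦ A t` is norm-resolvent continuous on `s`: for every `t₀ ∈ s`,
each `ζ ∈ ρ(A t₀)` belongs to `ρ(A t)` for all `t ∈ s` near `t₀`, and `(A t - ζ I)⁻¹` converges to
`(A t₀ - ζ I)⁻¹` in operator norm as `t → t₀` in `s`. -/
def NormResolventContinuousOn (A : ℝ → H →ₗ.[ℂ] H) (s : Set ℝ) : Prop :=
  ∀ t₀ ∈ s, ∀ ζ ∈ resolventSet (A t₀),
    (∀ᶠ t in 𝓝[s] t₀, ζ ∈ resolventSet (A t)) ∧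
      Filter.Tendsto (fun t => resolventOp (A t) ζ) (𝓝[s] t₀) (𝓝 (resolventOp (A t₀) ζ))

/-! ### Fractional powers -/

/-- The fractional power `A^γ`, `γ ∈ (0,1)`, of a bounded accretive operator, by the Balakrishnan
formula `A^γ = (sin (γ π) / π) ∫₀^∞ t^(γ-1) A (A + t I)⁻¹ dt`. -/
def bpow (A : H →L[ℂ] H) (γ : ℝ) : H →L[ℂ] H :=
  (Real.sin (γ * Real.pi) / Real.pi) •
    ∫ t in Set.Ioi (0 : ℝ), (t ^ (γ - 1)) • (A * Ring.inverse (A + (t : ℂ) • 1))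

/-- The contraction `T = (I - A)(I + A)⁻¹ = -I + 2 (A + I)⁻¹` attached to an `m`-accretive `A`. -/
def cayley (A : H →ₗ.[ℂ] H) : H →L[ℂ] H :=
  (2 : ℂ) • resolventOp A (-1) - 1

/-- The inverse of an injective bounded operator, as an operator with domain `ran R`. -/
def invOp (R : H →L[ℂ] H) : H →ₗ.[ℂ] H :=
  ((R : H →ₗ[ℂ] H).toPMap ⊤).inverse

/-- The fractional power `A^γ = (I - T)^γ ((I + T)^γ)⁻¹`, `T = (I - A)(I + A)⁻¹`, `γ ∈ (0,1)`, of an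
`m`-accretive operator `A`; its domain is `ran (I + T)^γ`. -/
def fracPow (A : H →ₗ.[ℂ] H) (γ : ℝ) : H →ₗ.[ℂ] H :=
  (bpow (1 - cayley A) γ : H →ₗ[ℂ] H).compPMap (invOp (bpow (1 + cayley A) γ))

/-! ### The operators of the construction -/

variable [CompleteSpace H]

/-- The nonnegative selfadjoint operator `(Q P_M Q)^(1/2)`. -/
def rootQPQ (Q : H →L[ℂ] H) (M : Submodule ℂ H) [M.HasOrthogonalProjection] : H →L[ℂ] H :=
  CFC.sqrt (Q * M.starProjection * Q)

open Classical in
/-- The bounded operator `Z₀ = i Q⁻¹ (Q P_M Q)^(1/2)`, that is, the solution of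
`Q Z₀ = i (Q P_M Q)^(1/2)` (unique when `ker Q = {0}`), and `0` if there is none. -/
def Zzero (Q : H →L[ℂ] H) (M : Submodule ℂ H) [M.HasOrthogonalProjection] : H →L[ℂ] H :=
  if h : ∃ Z : H →L[ℂ] H, Q * Z = Complex.I • rootQPQ Q M then h.choose else 0

/-- The denominator `(I + Z)^γ + (I - Z)^γ` of the `γ`-transform of `Z`. -/
def transformDenom (Z : H →L[ℂ] H) (γ : ℝ) : H →L[ℂ] H :=
  bpow (1 + Z) γ + bpow (1 - Z) γ

/-- The `γ`-transform `((I + Z)^γ - (I - Z)^γ) ((I + Z)^γ + (I - Z)^γ)⁻¹` of a contraction `Z`. -/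
def transform (Z : H →L[ℂ] H) (γ : ℝ) : H →L[ℂ] H :=
  (bpow (1 + Z) γ - bpow (1 - Z) γ) * Ring.inverse (transformDenom Z γ)

/-- `Z(t) = Z exp (-t (I - Z²))`. -/
def flow (Z : H →L[ℂ] H) (t : ℝ) : H →L[ℂ] H :=
  Z * NormedSpace.exp (-(t : ℂ) • (1 - Z ^ 2))

/-- The bounded operator `Q (I + Z)(I - Z*) Q`. -/
def sandwich (Q Z : H →L[ℂ] H) : H →L[ℂ] H :=
  Q * (1 + Z) * (1 - ContinuousLinearMap.adjoint Z) * Q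

/-- `Z_γ^(0)`, the `γ`-transform of `Z₀`. -/
def Zgamma (Q : H →L[ℂ] H) (M : Submodule ℂ H) [M.HasOrthogonalProjection] (γ : ℝ) : H →L[ℂ] H :=
  transform (Zzero Q M) γ

/-- `B_{γ,n}`, the inverse of `Q (I + Z^(2n+1)) (I - Z*^(2n+1)) Q` with `Z = Z_γ^(0)`. -/
def opB (Q : H →L[ℂ] H) (M : Submodule ℂ H) [M.HasOrthogonalProjection] (γ : ℝ) (n : ℕ) :
    H →ₗ.[ℂ] H :=
  invOp (sandwich Q (Zgamma Q M γ ^ (2 * n + 1)))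

/-- `S_γ(t)`, the inverse of `Q (I + Z(t)) (I - Z(t)*) Q` with `Z(t) = Z exp (-t (I - Z²))` and
`Z = Z_γ^(0)`. -/
def opS (Q : H →L[ℂ] H) (M : Submodule ℂ H) [M.HasOrthogonalProjection] (γ : ℝ) (t : ℝ) :
    H →ₗ.[ℂ] H :=
  invOp (sandwich Q (flow (Zgamma Q M γ) t))

end

end KatoRoot

open scoped InnerProductSpace Topology LinearPMap

namespace KatoRoot

noncomputable section

open MeasureTheory Set Filter

set_option linter.unusedSectionVars false

/-! ### The Balakrishnan integral in a Banach algebra -/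

section Balakrishnan

variable {𝔸 : Type*} [NormedRing 𝔸] [NormedAlgebra ℂ 𝔸]

/-- `a` is nonnegative in the sense of Balakrishnan and Komatsu (with constant `1`): every `t > 0`
satisfies `‖t (a + t)⁻¹‖ ≤ 1`. -/
def IsNonneg (a : 𝔸) : Prop :=
  ∀ t : ℝ, 0 < t → IsUnit (a + (t : ℂ) • 1) ∧ ‖(t : ℂ) • Ring.inverse (a + (t : ℂ) • 1)‖ ≤ 1

/-- The resolvent `(a + t)⁻¹`. -/
def res (a : 𝔸) (t : ℝ) : 𝔸 := Ring.inverse (a + (t : ℂ) • 1)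

/-- The integrand `t^(γ-1) a (a + t)⁻¹` of the Balakrishnan integral. -/
def balakIntegrand (γ : ℝ) (a : 𝔸) (t : ℝ) : 𝔸 := ((t ^ (γ - 1) : ℝ) : ℂ) • (a * res a t)

/-- The Balakrishnan integral `∫₀^∞ t^(γ-1) a (a + t)⁻¹ dt`. -/
def balak (γ : ℝ) (a : 𝔸) : 𝔸 := ∫ t in Ioi (0 : ℝ), balakIntegrand γ a t

/-- The integrable function `t^(γ-1) / (1 + t)`. -/
def majorant (γ t : ℝ) : ℝ := t ^ (γ - 1) / (1 + t)

theorem integrableOn_majorant {γ : ℝ} (h0 : 0 < γ) (h1 : γ < 1) :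
    IntegrableOn (majorant γ) (Ioi 0) := by
  have h := Real.integrableOn_rpowIntegrand₀₁_Ioi (p := γ) ⟨h0, h1⟩ zero_le_one
  refine h.congr_fun (fun t ht => ?_) measurableSet_Ioi
  change Real.rpowIntegrand₀₁ γ t 1 = _
  rw [Real.rpowIntegrand₀₁_eq_pow_div ⟨h0, h1⟩ (le_of_lt ht) zero_le_one, majorant, mul_one,
    add_comm]

theorem integral_majorant_pos {γ : ℝ} (h0 : 0 < γ) (h1 : γ < 1) :
    0 < ∫ t in Ioi (0 : ℝ), majorant γ t := by
  have h := Real.integral_rpowIntegrand₀₁_one_pos (p := γ) ⟨h0, h1⟩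
  refine h.trans_eq (setIntegral_congr_fun measurableSet_Ioi fun t ht => ?_)
  rw [Real.rpowIntegrand₀₁_eq_pow_div ⟨h0, h1⟩ (le_of_lt ht) zero_le_one, majorant, mul_one,
    add_comm]

theorem IsNonneg.isUnit {a : 𝔸} (ha : IsNonneg a) {t : ℝ} (ht : 0 < t) :
    IsUnit (a + (t : ℂ) • 1) := (ha t ht).1

theorem IsNonneg.norm_smul_res_le {a : 𝔸} (ha : IsNonneg a) {t : ℝ} (ht : 0 < t) :
    ‖(t : ℂ) • res a t‖ ≤ 1 := (ha t ht).2

theorem IsNonneg.add_mul_res {a : 𝔸} (ha : IsNonneg a) {t : ℝ} (ht : 0 < t) :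
    a * res a t + (t : ℂ) • res a t = 1 := by
  have := Ring.mul_inverse_cancel _ (ha.isUnit ht)
  rwa [add_mul, smul_mul_assoc, one_mul] at this

theorem commute_ringInverse {R : Type*} [Ring R] {a b : R} (h : Commute a b) :
    Commute a (Ring.inverse b) := by
  by_cases hb : IsUnit b
  · obtain ⟨u, rfl⟩ := hb
    rw [Ring.inverse_unit]
    exact h.units_inv_right
  · rw [Ring.inverse_non_unit _ hb]
    exact Commute.zero_right a

theorem commute_res (a : 𝔸) (t : ℝ) : Commute a (res a t) := by
  refine commute_ringInverse ?_
  exact (Commute.refl a).add_right ((Commute.one_right a).smul_right _)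

theorem commute_res_of_commute {a b : 𝔸} (h : Commute b a) (t : ℝ) : Commute b (res a t) := by
  refine commute_ringInverse ?_
  exact h.add_right ((Commute.one_right b).smul_right _)

theorem IsNonneg.norm_mul_res_le {a : 𝔸} (ha : IsNonneg a) {t : ℝ} (ht : 0 < t) :
    ‖a * res a t‖ * (1 + t) ≤ ‖(1 : 𝔸)‖ + 1 + ‖a‖ := by
  have h1 : ‖a * res a t‖ ≤ ‖(1 : 𝔸)‖ + 1 := by
    rw [eq_sub_of_add_eq (ha.add_mul_res ht)]
    exact (norm_sub_le _ _).trans (by gcongr; exact ha.norm_smul_res_le ht)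
  have h2 : ‖a * res a t‖ * t ≤ ‖a‖ := by
    calc ‖a * res a t‖ * t = ‖a * ((t : ℂ) • res a t)‖ := by
          rw [mul_smul_comm, norm_smul, Complex.norm_real, Real.norm_of_nonneg ht.le, mul_comm]
      _ ≤ ‖a‖ * ‖(t : ℂ) • res a t‖ := norm_mul_le _ _
      _ ≤ ‖a‖ * 1 := by gcongr; exact ha.norm_smul_res_le ht
      _ = ‖a‖ := mul_one _
  linarith

theorem IsNonneg.norm_balakIntegrand_le {a : 𝔸} (ha : IsNonneg a) (γ : ℝ) {t : ℝ} (ht : 0 < t) :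
    ‖balakIntegrand γ a t‖ ≤ (‖(1 : 𝔸)‖ + 1 + ‖a‖) * majorant γ t := by
  have h := ha.norm_mul_res_le ht
  have hp : 0 ≤ t ^ (γ - 1) := Real.rpow_nonneg ht.le _
  rw [balakIntegrand, norm_smul, Complex.norm_real, Real.norm_of_nonneg hp, majorant]
  rw [mul_div_assoc', le_div_iff₀ (by positivity)]
  nlinarith

/-- The function `t^γ a (a + t)⁻²`. -/
def balakDeriv (γ : ℝ) (a : 𝔸) (t : ℝ) : 𝔸 := ((t ^ γ : ℝ) : ℂ) • (a * res a t * res a t)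

theorem IsNonneg.norm_balakDeriv_le {a : 𝔸} (ha : IsNonneg a) (γ : ℝ) {t : ℝ} (ht : 0 < t) :
    ‖balakDeriv γ a t‖ ≤ (‖(1 : 𝔸)‖ + 1 + ‖a‖) * majorant γ t := by
  have : balakDeriv γ a t = balakIntegrand γ a t * ((t : ℂ) • res a t) := by
    rw [balakDeriv, balakIntegrand, smul_mul_assoc, mul_smul_comm, smul_smul, ← Complex.ofReal_mul]
    congr 3
    rw [← Real.rpow_add_one ht.ne']; ring_nf
  rw [this]
  calc _ ≤ ‖balakIntegrand γ a t‖ * ‖(t : ℂ) • res a t‖ := norm_mul_le _ _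
    _ ≤ ‖balakIntegrand γ a t‖ * 1 := by gcongr; exact ha.norm_smul_res_le ht
    _ ≤ _ := by rw [mul_one]; exact ha.norm_balakIntegrand_le γ ht

theorem commute_balak_of_commute [CompleteSpace 𝔸] {γ : ℝ} {a b : 𝔸} (h : Commute b a)
    (hint : IntegrableOn (balakIntegrand γ a) (Ioi 0)) : Commute b (balak γ a) := by
  rw [Commute, SemiconjBy, balak, ← integral_const_mul_of_integrable hint,
    ← integral_mul_const_of_integrable hint]
  congr 1
  ext t
  exact ((h.mul_right (commute_res_of_commute h t)).smul_right _).eq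

variable [CompleteSpace 𝔸]

theorem IsNonneg.hasDerivAt_res {a : 𝔸} (ha : IsNonneg a) {t : ℝ} (ht : 0 < t) :
    HasDerivAt (res a) (-(res a t * res a t)) t := by
  obtain ⟨u, hu⟩ := ha.isUnit ht
  have h1 : HasDerivAt (fun s : ℝ => a + (s : ℂ) • (1 : 𝔸)) 1 t := by
    have := ((Complex.ofRealCLM.hasDerivAt (x := t)).smul_const (1 : 𝔸)).const_add a
    simpa using this
  have h2 := hasFDerivAt_ringInverse (𝕜 := ℝ) u
  rw [hu] at h2
  have h3 := h2.comp_hasDerivAt t h1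
  have h4 : (↑u⁻¹ : 𝔸) = res a t := by rw [res, ← hu, Ring.inverse_unit]
  simp only [h4, Function.comp_def, neg_apply,
    ContinuousLinearMap.mulLeftRight_apply, mul_one] at h3
  exact h3

theorem IsNonneg.continuousOn_res {a : 𝔸} (ha : IsNonneg a) : ContinuousOn (res a) (Ioi 0) :=
  fun _ ht => (ha.hasDerivAt_res ht).continuousAt.continuousWithinAt

theorem continuousOn_ofReal_rpow (p : ℝ) :
    ContinuousOn (fun t : ℝ => ((t ^ p : ℝ) : ℂ)) (Ioi 0) :=
  Complex.continuous_ofReal.comp_continuousOn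
    (continuousOn_id.rpow_const fun _ ht => Or.inl (ne_of_gt ht))

theorem IsNonneg.continuousOn_balakIntegrand {a : 𝔸} (ha : IsNonneg a) (γ : ℝ) :
    ContinuousOn (balakIntegrand γ a) (Ioi 0) :=
  (continuousOn_ofReal_rpow _).smul (continuousOn_const.mul ha.continuousOn_res)

theorem IsNonneg.integrableOn_balakIntegrand {a : 𝔸} (ha : IsNonneg a) {γ : ℝ} (h0 : 0 < γ)
    (h1 : γ < 1) : IntegrableOn (balakIntegrand γ a) (Ioi 0) := by
  refine ((integrableOn_majorant h0 h1).const_mul (‖(1 : 𝔸)‖ + 1 + ‖a‖)).mono'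
    ((ha.continuousOn_balakIntegrand γ).aestronglyMeasurable measurableSet_Ioi) ?_
  filter_upwards [ae_restrict_mem measurableSet_Ioi] with t ht
  exact ha.norm_balakIntegrand_le γ ht

theorem IsNonneg.continuousOn_balakDeriv {a : 𝔸} (ha : IsNonneg a) (γ : ℝ) :
    ContinuousOn (balakDeriv γ a) (Ioi 0) :=
  (continuousOn_ofReal_rpow _).smul
    ((continuousOn_const.mul ha.continuousOn_res).mul ha.continuousOn_res)

theorem IsNonneg.integrableOn_balakDeriv {a : 𝔸} (ha : IsNonneg a) {γ : ℝ} (h0 : 0 < γ)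
    (h1 : γ < 1) : IntegrableOn (balakDeriv γ a) (Ioi 0) := by
  refine ((integrableOn_majorant h0 h1).const_mul (‖(1 : 𝔸)‖ + 1 + ‖a‖)).mono'
    ((ha.continuousOn_balakDeriv γ).aestronglyMeasurable measurableSet_Ioi) ?_
  filter_upwards [ae_restrict_mem measurableSet_Ioi] with t ht
  exact ha.norm_balakDeriv_le γ ht

theorem IsNonneg.commute_balak {a b : 𝔸} (ha : IsNonneg a) {γ : ℝ} (h0 : 0 < γ) (h1 : γ < 1)
    (h : Commute b a) : Commute b (balak γ a) :=
  commute_balak_of_commute h (ha.integrableOn_balakIntegrand h0 h1)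

/-- Integration by parts: `∫ t^γ a (a + t)⁻² dt = γ ∫ t^(γ-1) a (a + t)⁻¹ dt`. -/
theorem IsNonneg.integral_balakDeriv {a : 𝔸} (ha : IsNonneg a) {γ : ℝ} (h0 : 0 < γ) (h1 : γ < 1) :
    ∫ t in Ioi (0 : ℝ), balakDeriv γ a t = (γ : ℂ) • balak γ a := by
  set C := ‖(1 : 𝔸)‖ + 1 + ‖a‖ with hC
  let f : ℝ → 𝔸 := fun t => ((t ^ γ : ℝ) : ℂ) • (a * res a t)
  have hf0 : f 0 = 0 := by simp [f, Real.zero_rpow h0.ne']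
  have hfn : ∀ t : ℝ, 0 < t → ‖f t‖ ≤ C * (t ^ γ / (1 + t)) := by
    intro t ht
    have h := ha.norm_mul_res_le ht
    have hp : 0 ≤ t ^ γ := Real.rpow_nonneg ht.le _
    simp only [f]
    rw [norm_smul, Complex.norm_real, Real.norm_of_nonneg hp, mul_div_assoc',
      le_div_iff₀ (by positivity)]
    nlinarith
  have hC0 : 0 ≤ C := by positivity
  have hderiv : ∀ t ∈ Ioi (0 : ℝ),
      HasDerivAt f ((γ : ℂ) • balakIntegrand γ a t - balakDeriv γ a t) t := by
    intro t ht
    have hp : HasDerivAt (fun t : ℝ => ((t ^ γ : ℝ) : ℂ)) ((γ * t ^ (γ - 1) : ℝ) : ℂ) t :=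
      (Real.hasDerivAt_rpow_const (Or.inl (ne_of_gt ht))).ofReal_comp
    have := hp.smul ((ha.hasDerivAt_res ht).const_mul a)
    convert! this using 1
    simp only [balakIntegrand, balakDeriv, smul_smul, mul_neg, smul_neg, mul_assoc]
    push_cast
    abel
  have hcont : ContinuousWithinAt f (Ici 0) 0 := by
    rw [ContinuousWithinAt, hf0]
    have hlim : Tendsto (fun t : ℝ => C * (t ^ γ / (1 + t))) (𝓝[Ici 0] 0) (𝓝 0) := by
      have : ContinuousAt (fun t : ℝ => C * (t ^ γ / (1 + t))) 0 := by
        refine continuousAt_const.mul (ContinuousAt.div ?_ (by fun_prop) (by norm_num))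
        exact Real.continuousAt_rpow_const _ _ (Or.inr h0.le)
      have h := this.tendsto.mono_left (nhdsWithin_le_nhds (s := Ici 0))
      simpa [Real.zero_rpow h0.ne'] using h
    refine squeeze_zero_norm' ?_ hlim
    filter_upwards [self_mem_nhdsWithin] with t ht
    rcases eq_or_lt_of_le (show (0:ℝ) ≤ t from ht) with rfl | ht
    · simp [hf0, Real.zero_rpow h0.ne']
    · exact hfn t ht
  have htop : Tendsto f atTop (𝓝 0) := by
    have hlim : Tendsto (fun t : ℝ => C * t ^ (-(1 - γ))) atTop (𝓝 0) := by
      simpa using (tendsto_rpow_neg_atTop (by linarith : 0 < 1 - γ)).const_mul C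
    refine squeeze_zero_norm' ?_ hlim
    filter_upwards [eventually_gt_atTop 0] with t ht
    refine (hfn t ht).trans (mul_le_mul_of_nonneg_left ?_ hC0)
    rw [div_le_iff₀ (by positivity), neg_sub, Real.rpow_sub_one ht.ne', div_mul_eq_mul_div,
      le_div_iff₀ ht]
    have := Real.rpow_nonneg ht.le γ
    nlinarith
  have hI : IntegrableOn (fun t => (γ : ℂ) • balakIntegrand γ a t) (Ioi 0) :=
    (ha.integrableOn_balakIntegrand h0 h1).smul (γ : ℂ)
  have hD := ha.integrableOn_balakDeriv h0 h1
  have key := integral_Ioi_of_hasDerivAt_of_tendsto hcont hderiv (hI.sub hD) htop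
  rw [integral_sub hI hD, hf0, sub_zero, sub_eq_zero] at key
  rw [← key]
  exact integral_smul _ _

end Balakrishnan

section Paths

variable {𝔸 : Type*} [NormedRing 𝔸] [NormedAlgebra ℂ 𝔸] [CompleteSpace 𝔸]

theorem hasDerivAt_ringInverse_comp {a : ℝ → 𝔸} {a' : 𝔸} {x : ℝ} (ha : HasDerivAt a a' x)
    (hu : IsUnit (a x)) :
    HasDerivAt (fun y => Ring.inverse (a y))
      (-(Ring.inverse (a x) * a' * Ring.inverse (a x))) x := by
  obtain ⟨u, hu⟩ := hu
  have h2 := hasFDerivAt_ringInverse (𝕜 := ℝ) u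
  rw [hu] at h2
  have h3 := h2.comp_hasDerivAt x ha
  have h4 : (↑u⁻¹ : 𝔸) = Ring.inverse (a x) := by rw [← hu, Ring.inverse_unit]
  simp only [h4, Function.comp_def, neg_apply,
    ContinuousLinearMap.mulLeftRight_apply] at h3
  exact h3

theorem IsNonneg.hasDerivAt_balakIntegrand {γ : ℝ} {a : ℝ → 𝔸} {b : 𝔸} {x t : ℝ}
    (hn : IsNonneg (a x)) (ha : HasDerivAt a (a x * b) x) (hb : Commute b (a x)) (ht : 0 < t) :
    HasDerivAt (fun y => balakIntegrand γ (a y) t) (balakDeriv γ (a x) t * b) x := by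
  have h1 : HasDerivAt (fun y => res (a y) t)
      (-(res (a x) t * (a x * b) * res (a x) t)) x :=
    hasDerivAt_ringInverse_comp (a := fun y => a y + (t : ℂ) • 1) (ha.add_const _) (hn.isUnit ht)
  have h2 := (ha.mul h1).const_smul ((t ^ (γ - 1) : ℝ) : ℂ)
  refine h2.congr_deriv ?_
  have hbr : b * res (a x) t = res (a x) t * b := commute_res_of_commute hb t
  have har : a x * res (a x) t = res (a x) t * a x := commute_res (a x) t
  have hone : res (a x) t = a x * res (a x) t * res (a x) t +
      (t : ℂ) • (res (a x) t * res (a x) t) := by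
    have := congrArg (· * res (a x) t) (hn.add_mul_res ht)
    simp only [add_mul, one_mul, smul_mul_assoc] at this
    exact this.symm
  have key : a x * b * res (a x) t + a x * -(res (a x) t * (a x * b) * res (a x) t) =
      (t : ℂ) • (a x * res (a x) t * res (a x) t * b) := by
    calc _ = a x * (res (a x) t - res (a x) t * a x * res (a x) t) * b := by
          rw [mul_neg, mul_assoc (a x) b, hbr]
          simp only [mul_assoc, hbr]
          noncomm_ring
      _ = a x * ((t : ℂ) • (res (a x) t * res (a x) t)) * b := by
          rw [← har, sub_eq_of_eq_add' hone]
      _ = _ := by simp only [mul_smul_comm, smul_mul_assoc, mul_assoc]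
  rw [key, balakDeriv, smul_smul, ← Complex.ofReal_mul, ← Real.rpow_add_one ht.ne',
    smul_mul_assoc, sub_add_cancel]

/-- Differentiation of the Balakrishnan integral along a path `a` with `a' = a b`, `b` commuting
with `a`. -/
theorem hasDerivAt_balak {γ : ℝ} (h0 : 0 < γ) (h1 : γ < 1) {a b : ℝ → 𝔸} {x : ℝ}
    (h : ∀ᶠ y in 𝓝 x, IsNonneg (a y) ∧ HasDerivAt a (a y * b y) y ∧ Commute (b y) (a y))
    (hb : ContinuousAt b x) :
    HasDerivAt (fun y => balak γ (a y)) ((γ : ℂ) • (balak γ (a x) * b x)) x := by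
  have hx := h.self_of_nhds
  have hac : ContinuousAt a x := hx.2.1.continuousAt
  have hA : ∀ᶠ y in 𝓝 x, ‖a y‖ < ‖a x‖ + 1 := hac.norm.eventually_lt_const (by linarith)
  have hB : ∀ᶠ y in 𝓝 x, ‖b y‖ < ‖b x‖ + 1 := hb.norm.eventually_lt_const (by linarith)
  have hs : {y | (IsNonneg (a y) ∧ HasDerivAt a (a y * b y) y ∧ Commute (b y) (a y)) ∧
      ‖a y‖ < ‖a x‖ + 1 ∧ ‖b y‖ < ‖b x‖ + 1} ∈ 𝓝 x := h.and (hA.and hB)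
  have hI := hx.1.integrableOn_balakDeriv h0 h1
  have main := (hasDerivAt_integral_of_dominated_loc_of_deriv_le
    (μ := volume.restrict (Ioi (0 : ℝ))) (F := fun y t => balakIntegrand γ (a y) t)
    (F' := fun y t => balakDeriv γ (a y) t * b y)
    (bound := fun t => ((‖(1 : 𝔸)‖ + 1 + (‖a x‖ + 1)) * majorant γ t) * (‖b x‖ + 1)) hs
    (h.mono fun y hy => (hy.1.continuousOn_balakIntegrand γ).aestronglyMeasurable
      measurableSet_Ioi)
    (hx.1.integrableOn_balakIntegrand h0 h1)
    (((hx.1.continuousOn_balakDeriv γ).mul continuousOn_const).aestronglyMeasurable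
      measurableSet_Ioi) ?_
    (((integrableOn_majorant h0 h1).const_mul _).mul_const _) ?_).2
  · refine main.congr_deriv ?_
    rw [integral_mul_const_of_integrable hI, hx.1.integral_balakDeriv h0 h1, smul_mul_assoc]
  · filter_upwards [ae_restrict_mem measurableSet_Ioi] with t ht y hy
    have hm : 0 ≤ majorant γ t :=
      div_nonneg (Real.rpow_nonneg (le_of_lt ht) _) (by linarith [show (0 : ℝ) < t from ht])
    refine (norm_mul_le _ _).trans (mul_le_mul ?_ hy.2.2.le (norm_nonneg _) (by positivity))
    refine (hy.1.1.norm_balakDeriv_le γ ht).trans (mul_le_mul_of_nonneg_right ?_ hm)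
    linarith [hy.2.1]
  · filter_upwards [ae_restrict_mem measurableSet_Ioi] with t ht y hy
    exact hy.1.1.hasDerivAt_balakIntegrand hy.1.2.1 hy.1.2.2 ht

theorem continuousWithinAt_balak {X : Type*} [TopologicalSpace X] [FirstCountableTopology X]
    {γ : ℝ} (h0 : 0 < γ) (h1 : γ < 1) {a : X → 𝔸} {s : Set X} {x : X} (hx : x ∈ s)
    (h : ∀ y ∈ s, IsNonneg (a y)) (ha : ContinuousWithinAt a s x) :
    ContinuousWithinAt (fun y => balak γ (a y)) s x := by
  have hA : ∀ᶠ y in 𝓝[s] x, ‖a y‖ < ‖a x‖ + 1 := ha.norm.eventually_lt_const (by linarith)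
  refine continuousWithinAt_of_dominated (μ := volume.restrict (Ioi (0 : ℝ)))
    (F := fun y t => balakIntegrand γ (a y) t)
    (bound := fun t => (‖(1 : 𝔸)‖ + 1 + (‖a x‖ + 1)) * majorant γ t) ?_ ?_
    ((integrableOn_majorant h0 h1).const_mul _) ?_
  · filter_upwards [self_mem_nhdsWithin] with y hy
    exact ((h y hy).continuousOn_balakIntegrand γ).aestronglyMeasurable measurableSet_Ioi
  · filter_upwards [self_mem_nhdsWithin, hA] with y hy hay
    filter_upwards [ae_restrict_mem measurableSet_Ioi] with t ht
    have hm : 0 ≤ majorant γ t :=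
      div_nonneg (Real.rpow_nonneg (le_of_lt ht) _) (by linarith [show (0 : ℝ) < t from ht])
    refine ((h y hy).norm_balakIntegrand_le γ ht).trans (mul_le_mul_of_nonneg_right ?_ hm)
    linarith
  · filter_upwards [ae_restrict_mem measurableSet_Ioi] with t ht
    have hr : ContinuousWithinAt (fun y => res (a y) t) s x := by
      obtain ⟨u, hu⟩ := (h x hx).isUnit ht
      have := NormedRing.inverse_continuousAt u
      rw [hu] at this
      exact ContinuousAt.comp_continuousWithinAt (f := fun y => a y + (t : ℂ) • 1) this
        (ha.add continuousWithinAt_const)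
    exact (ha.mul hr).const_smul _

/-- If `a' = a b` and `c' = -γ c b` along a path, then `c` times the Balakrishnan integral of `a`
is constant. -/
theorem mul_balak_eq_of_path {γ : ℝ} (h0 : 0 < γ) (h1 : γ < 1) {a b c : ℝ → 𝔸} {T : ℝ}
    (hT : 0 ≤ T) (hn : ∀ x ∈ Icc 0 T, IsNonneg (a x)) (hac : ContinuousOn a (Icc 0 T))
    (hcc : ContinuousOn c (Icc 0 T))
    (h : ∀ x ∈ Ico 0 T, ∀ᶠ y in 𝓝 x,
      IsNonneg (a y) ∧ HasDerivAt a (a y * b y) y ∧ Commute (b y) (a y))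
    (hb : ∀ x ∈ Ico 0 T, ContinuousAt b x)
    (hc : ∀ x ∈ Ico 0 T, HasDerivAt c (-((γ : ℂ) • (c x * b x))) x) :
    c T * balak γ (a T) = c 0 * balak γ (a 0) := by
  refine constant_of_has_deriv_right_zero (f := fun x => c x * balak γ (a x)) (a := 0) (b := T)
    (hcc.mul fun x hx => continuousWithinAt_balak h0 h1 hx hn (hac x hx)) (fun x hx => ?_) T
    ⟨hT, le_rfl⟩
  have hx' := (h x hx).self_of_nhds
  have hd := (hc x hx).mul (hasDerivAt_balak h0 h1 (h x hx) (hb x hx))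
  refine (hd.congr_deriv ?_).hasDerivWithinAt
  have : balak γ (a x) * b x = b x * balak γ (a x) :=
    (hx'.1.commute_balak h0 h1 hx'.2.2).eq.symm
  rw [this]
  simp only [neg_mul, mul_smul_comm, smul_mul_assoc, mul_assoc]
  exact neg_add_cancel _

end Paths

section Scalar

theorem isNonneg_complex {z : ℂ} (hz : 0 ≤ z.re) : IsNonneg z := by
  intro t ht
  have h1 : t ≤ ‖z + (t : ℂ) • 1‖ := by
    refine le_trans ?_ (Complex.re_le_norm _)
    simp [hz]
  have h2 : z + (t : ℂ) • 1 ≠ 0 := norm_pos_iff.mp (ht.trans_le h1)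
  refine ⟨h2.isUnit, ?_⟩
  rw [Ring.inverse_eq_inv', norm_smul, norm_inv, Complex.norm_real, Real.norm_of_nonneg ht.le,
    ← div_eq_mul_inv]
  exact div_le_one_of_le₀ h1 (norm_nonneg _)

/-- The normalising constant `∫₀^∞ t^(γ-1) / (1 + t) dt`. -/
def balakConst (γ : ℝ) : ℝ := ∫ t in Ioi (0 : ℝ), majorant γ t

theorem balakConst_pos {γ : ℝ} (h0 : 0 < γ) (h1 : γ < 1) : 0 < balakConst γ :=
  integral_majorant_pos h0 h1

theorem balak_one (γ : ℝ) : balak γ (1 : ℂ) = balakConst γ := by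
  rw [balak, balakConst, ← integral_complex_ofReal]
  refine setIntegral_congr_fun measurableSet_Ioi fun t ht => ?_
  simp only [balakIntegrand, res, majorant, Ring.inverse_eq_inv', smul_eq_mul, mul_one, one_mul]
  push_cast
  rw [div_eq_mul_inv]

theorem balak_zero {𝔸 : Type*} [NormedRing 𝔸] [NormedAlgebra ℂ 𝔸] (γ : ℝ) :
    balak γ (0 : 𝔸) = 0 := by
  simp [balak, balakIntegrand]

/-- The Balakrishnan integral of a point `exp l` of the open right half-plane. -/
theorem balak_exp {γ : ℝ} (h0 : 0 < γ) (h1 : γ < 1) {l : ℂ} (hl : |l.im| < Real.pi / 2) :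
    balak γ (Complex.exp l) = balakConst γ * Complex.exp (γ * l) := by
  have hre : ∀ x : ℝ, |x| * |l.im| < Real.pi / 2 → IsNonneg (Complex.exp (x * l)) := by
    intro x hx
    refine isNonneg_complex ?_
    rw [Complex.exp_re]
    refine mul_nonneg (Real.exp_pos _).le (Real.cos_nonneg_of_mem_Icc (abs_le.mp ?_))
    have : (↑x * l).im = x * l.im := by simp
    rw [this, abs_mul]
    exact hx.le
  have hexp : ∀ (w : ℂ) (x : ℝ), HasDerivAt (fun y : ℝ => Complex.exp (y * w))
      (Complex.exp (x * w) * w) x := by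
    intro w x
    have := ((Complex.ofRealCLM.hasDerivAt (x := x)).mul_const w).cexp
    simpa using this
  have key := mul_balak_eq_of_path h0 h1 (a := fun x : ℝ => Complex.exp (x * l))
    (b := fun _ => l) (c := fun x : ℝ => Complex.exp (x * (-(γ * l)))) zero_le_one
    (fun x hx => hre x ?_) (by fun_prop) (by fun_prop) (fun x hx => ?_)
    (fun x hx => continuousAt_const) (fun x hx => ?_)
  · simp only [Complex.ofReal_one, one_mul, Complex.ofReal_zero, zero_mul, Complex.exp_zero,
      balak_one] at key
    rw [← key, mul_comm (Complex.exp _), mul_assoc, ← Complex.exp_add, neg_add_cancel,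
      Complex.exp_zero, mul_one]
  · rw [abs_of_nonneg hx.1]
    nlinarith [hx.1, hx.2, abs_nonneg l.im]
  · have hopen : ∀ᶠ y in 𝓝 x, |y| * |l.im| < Real.pi / 2 := by
      refine ContinuousAt.eventually_lt (f := fun y : ℝ => |y| * |l.im|) (by fun_prop)
        continuousAt_const ?_
      rw [abs_of_nonneg hx.1]
      nlinarith [hx.1, hx.2, abs_nonneg l.im]
    filter_upwards [hopen] with y hy
    exact ⟨hre y hy, hexp l y, Commute.all _ _⟩
  · refine (hexp _ x).congr_deriv ?_
    simp only [smul_eq_mul]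
    ring

end Scalar

section Homs

variable {𝔸 𝔹 : Type*} [NormedRing 𝔸] [NormedAlgebra ℂ 𝔸] [CompleteSpace 𝔸]
  [NormedRing 𝔹] [NormedAlgebra ℂ 𝔹] [CompleteSpace 𝔹]

theorem map_ringInverse {R S F : Type*} [Semiring R] [Semiring S] [FunLike F R S]
    [RingHomClass F R S] (φ : F) {a : R} (ha : IsUnit a) :
    φ (Ring.inverse a) = Ring.inverse (φ a) := by
  obtain ⟨u, rfl⟩ := ha
  have h : φ u = (Units.map ((φ : R →+* S) : R →* S) u : S) := rfl
  rw [Ring.inverse_unit, h, Ring.inverse_unit]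
  rfl

/-- Continuous algebra homomorphisms commute with the Balakrishnan integral. -/
theorem map_balak (φ : 𝔸 →ₐ[ℂ] 𝔹) (hφ : Continuous φ) {γ : ℝ} (h0 : 0 < γ) (h1 : γ < 1) {a : 𝔸}
    (ha : IsNonneg a) : φ (balak γ a) = balak γ (φ a) := by
  let ψ : 𝔸 →L[ℂ] 𝔹 := ⟨φ.toLinearMap, hφ⟩
  have h := ψ.integral_comp_comm (ha.integrableOn_balakIntegrand h0 h1)
  change ψ (balak γ a) = _
  rw [balak, balak, ← h]
  refine setIntegral_congr_fun measurableSet_Ioi fun t ht => ?_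
  change φ (balakIntegrand γ a t) = _
  simp only [balakIntegrand, res, map_smul, map_mul, map_ringInverse φ (ha.isUnit ht), map_add,
    map_one]

theorem balak_one_eq {γ : ℝ} (h0 : 0 < γ) (h1 : γ < 1) :
    balak γ (1 : 𝔸) = (balakConst γ : ℂ) • 1 := by
  have := map_balak (Algebra.ofId ℂ 𝔸) (continuous_algebraMap ℂ 𝔸) h0 h1
    (isNonneg_complex (z := 1) (by simp))
  rw [map_one, balak_one] at this
  rw [← this, ← Algebra.algebraMap_eq_smul_one]
  rfl

end Homs

section Accretive

variable {H : Type*} [NormedAddCommGroup H] [InnerProductSpace ℂ H]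

/-- A bounded operator with nonnegative real part. -/
def IsAccretiveCLM (A : H →L[ℂ] H) : Prop := ∀ u, 0 ≤ (⟪u, A u⟫_ℂ).re

theorem re_inner_self_eq (u : H) : (⟪u, u⟫_ℂ).re = ‖u‖ ^ 2 := by
  rw [inner_self_eq_norm_sq_to_K]
  norm_cast

theorem IsAccretiveCLM.add {A B : H →L[ℂ] H} (hA : IsAccretiveCLM A) (hB : IsAccretiveCLM B) :
    IsAccretiveCLM (A + B) := fun u => by
  rw [add_apply, inner_add_right, Complex.add_re]
  exact add_nonneg (hA u) (hB u)

theorem IsAccretiveCLM.smul {A : H →L[ℂ] H} (hA : IsAccretiveCLM A) {r : ℝ} (hr : 0 ≤ r) :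
    IsAccretiveCLM ((r : ℂ) • A) := fun u => by
  rw [smul_apply, inner_smul_right, Complex.re_ofReal_mul]
  exact mul_nonneg hr (hA u)

theorem isAccretiveCLM_one : IsAccretiveCLM (1 : H →L[ℂ] H) := fun u => by
  rw [one_apply_eq_self, re_inner_self_eq]
  positivity

variable [CompleteSpace H]

theorem isUnit_of_re_inner_ge {A : H →L[ℂ] H} {c : ℝ} (hc : 0 < c)
    (h : ∀ u, c * ‖u‖ ^ 2 ≤ (⟪u, A u⟫_ℂ).re) : IsUnit A := by
  refine ContinuousLinearMap.isUnit_of_forall_le_norm_inner_map A (c := ⟨c, hc.le⟩) hc fun u => ?_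
  rw [norm_inner_symm]
  calc ‖u‖ ^ 2 * c = c * ‖u‖ ^ 2 := mul_comm _ _
    _ ≤ _ := h u
    _ ≤ _ := Complex.re_le_norm _

theorem IsAccretiveCLM.re_inner_add_ge {A : H →L[ℂ] H} (hA : IsAccretiveCLM A) (t : ℝ) (u : H) :
    t * ‖u‖ ^ 2 ≤ (⟪u, (A + (t : ℂ) • 1) u⟫_ℂ).re := by
  rw [add_apply, smul_apply, one_apply_eq_self, inner_add_right, inner_smul_right, Complex.add_re,
    Complex.re_ofReal_mul, re_inner_self_eq]
  linarith [hA u]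

theorem ringInverse_apply_apply {A : H →L[ℂ] H} (hA : IsUnit A) (u : H) :
    A (Ring.inverse A u) = u :=
  DFunLike.congr_fun (Ring.mul_inverse_cancel A hA) u

theorem ringInverse_apply_self {A : H →L[ℂ] H} (hA : IsUnit A) (u : H) :
    Ring.inverse A (A u) = u :=
  DFunLike.congr_fun (Ring.inverse_mul_cancel A hA) u

theorem IsAccretiveCLM.isUnit_add {A : H →L[ℂ] H} (hA : IsAccretiveCLM A) {t : ℝ} (ht : 0 < t) :
    IsUnit (A + (t : ℂ) • 1) :=
  isUnit_of_re_inner_ge ht (hA.re_inner_add_ge t)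

theorem IsAccretiveCLM.isUnit_one_add {A : H →L[ℂ] H} (hA : IsAccretiveCLM A) :
    IsUnit (1 + A) := by
  simpa [add_comm] using hA.isUnit_add one_pos

theorem IsAccretiveCLM.isNonneg {A : H →L[ℂ] H} (hA : IsAccretiveCLM A) : IsNonneg A := by
  intro t ht
  have hu := hA.isUnit_add ht
  refine ⟨hu, ContinuousLinearMap.opNorm_le_bound _ zero_le_one fun u => ?_⟩
  rw [smul_apply, norm_smul, Complex.norm_real, Real.norm_of_nonneg ht.le, one_mul]
  set v := Ring.inverse (A + (t : ℂ) • 1) u with hv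
  have h1 := hA.re_inner_add_ge t v
  rw [hv, ringInverse_apply_apply hu, ← hv] at h1
  have h2 : (⟪v, u⟫_ℂ).re ≤ ‖v‖ * ‖u‖ :=
    (Complex.re_le_norm _).trans (norm_inner_le_norm _ _)
  rcases (norm_nonneg v).eq_or_lt with h | h
  · rw [← h, mul_zero]; exact norm_nonneg u
  · exact le_of_mul_le_mul_left (by nlinarith) h

theorem IsAccretiveCLM.mul_inverse {A B : H →L[ℂ] H} (hB : IsUnit B)
    (h : ∀ u, 0 ≤ (⟪B u, A u⟫_ℂ).re) : IsAccretiveCLM (A * Ring.inverse B) := fun u => by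
  have := h (Ring.inverse B u)
  rwa [ringInverse_apply_apply hB] at this

/-- The operator `R (1 + R)⁻¹`, up to the factor `2` the resolvent `(R⁻¹ + 1)⁻¹` of the inverse. -/
def yosida (R : H →L[ℂ] H) : H →L[ℂ] H := (2 : ℂ) • (R * Ring.inverse (1 + R))

theorem IsAccretiveCLM.one_add_smul {R : H →L[ℂ] H} (hR : IsAccretiveCLM R) (x : ℝ) :
    IsAccretiveCLM (1 + ((x ^ 2 : ℝ) : ℂ) • R) :=
  isAccretiveCLM_one.add (hR.smul (sq_nonneg x))

theorem IsAccretiveCLM.isUnit_one_add_smul {R : H →L[ℂ] H} (hR : IsAccretiveCLM R) (x : ℝ) :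
    IsUnit (1 + ((x ^ 2 : ℝ) : ℂ) • R) :=
  (hR.smul (sq_nonneg x)).isUnit_one_add

theorem hasDerivAt_one_add_smul (R : H →L[ℂ] H) (x : ℝ) :
    HasDerivAt (fun y : ℝ => 1 + ((y ^ 2 : ℝ) : ℂ) • R) (((2 * x : ℝ) : ℂ) • R) x := by
  have h := ((hasDerivAt_pow 2 x).ofReal_comp.smul_const R).const_add (1 : H →L[ℂ] H)
  simpa using h

/-- The logarithmic derivative of the path `1 + x² R`. -/
def logDerivPath (R : H →L[ℂ] H) (x : ℝ) : H →L[ℂ] H :=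
  ((2 * x : ℝ) : ℂ) • (R * Ring.inverse (1 + ((x ^ 2 : ℝ) : ℂ) • R))

theorem commute_one_add_smul (R : H →L[ℂ] H) (x : ℂ) : Commute R (1 + x • R) :=
  (Commute.one_right R).add_right ((Commute.refl R).smul_right x)

theorem commute_inverse_one_add_smul (R : H →L[ℂ] H) (x : ℂ) :
    Commute R (Ring.inverse (1 + x • R)) :=
  commute_ringInverse (commute_one_add_smul R x)

theorem commute_logDerivPath (R : H →L[ℂ] H) (x : ℝ) {y : ℂ} :
    Commute (logDerivPath R x) (1 + y • R) := by
  have h : Commute R (logDerivPath R x) :=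
    ((Commute.refl R).mul_right (commute_inverse_one_add_smul R _)).smul_right _
  exact (Commute.one_right _).add_right (h.symm.smul_right _)

theorem IsAccretiveCLM.mul_logDerivPath {R : H →L[ℂ] H} (hR : IsAccretiveCLM R) (x : ℝ) :
    (1 + ((x ^ 2 : ℝ) : ℂ) • R) * logDerivPath R x = ((2 * x : ℝ) : ℂ) • R := by
  rw [logDerivPath, mul_smul_comm, (commute_inverse_one_add_smul R _).eq, ← mul_assoc,
    Ring.mul_inverse_cancel _ (hR.isUnit_one_add_smul x), one_mul]

theorem IsAccretiveCLM.hasDerivAt_inverse_one_add_smul {R : H →L[ℂ] H} (hR : IsAccretiveCLM R)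
    (x : ℝ) : HasDerivAt (fun y : ℝ => Ring.inverse (1 + ((y ^ 2 : ℝ) : ℂ) • R))
      (-(Ring.inverse (1 + ((x ^ 2 : ℝ) : ℂ) • R) * logDerivPath R x)) x := by
  refine (hasDerivAt_ringInverse_comp (hasDerivAt_one_add_smul R x)
    (hR.isUnit_one_add_smul x)).congr_deriv ?_
  rw [logDerivPath, mul_smul_comm, mul_smul_comm, smul_mul_assoc, mul_assoc]

theorem IsAccretiveCLM.continuous_logDerivPath {R : H →L[ℂ] H} (hR : IsAccretiveCLM R) :
    Continuous (logDerivPath R) := by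
  have : Continuous fun y : ℝ => Ring.inverse (1 + ((y ^ 2 : ℝ) : ℂ) • R) :=
    continuous_iff_continuousAt.mpr fun x => (hR.hasDerivAt_inverse_one_add_smul x).continuousAt
  unfold logDerivPath
  fun_prop

theorem IsAccretiveCLM.eventually_path {R : H →L[ℂ] H} (hR : IsAccretiveCLM R) (x : ℝ) :
    ∀ᶠ y in 𝓝 x, IsNonneg (1 + ((y ^ 2 : ℝ) : ℂ) • R) ∧
      HasDerivAt (fun y : ℝ => 1 + ((y ^ 2 : ℝ) : ℂ) • R)
        ((1 + ((y ^ 2 : ℝ) : ℂ) • R) * logDerivPath R y) y ∧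
      Commute (logDerivPath R y) (1 + ((y ^ 2 : ℝ) : ℂ) • R) :=
  Eventually.of_forall fun y => ⟨(hR.one_add_smul y).isNonneg,
    (hasDerivAt_one_add_smul R y).congr_deriv (hR.mul_logDerivPath y).symm,
    commute_logDerivPath R y⟩

theorem IsAccretiveCLM.hasDerivAt_balak_path {R : H →L[ℂ] H} (hR : IsAccretiveCLM R) (x : ℝ) :
    HasDerivAt (fun y : ℝ => balak (1 / 2) (1 + ((y ^ 2 : ℝ) : ℂ) • R))
      (((1 / 2 : ℝ) : ℂ) • (balak (1 / 2) (1 + ((x ^ 2 : ℝ) : ℂ) • R) * logDerivPath R x)) x :=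
  hasDerivAt_balak (by norm_num) (by norm_num) (hR.eventually_path x)
    hR.continuous_logDerivPath.continuousAt

theorem IsAccretiveCLM.balak_mul_inverse_mul_balak {R : H →L[ℂ] H} (hR : IsAccretiveCLM R) :
    balak (1 / 2) (1 + R) * Ring.inverse (1 + R) * balak (1 / 2) (1 + R) =
      ((balakConst (1 / 2) : ℂ) ^ 2) • (1 : H →L[ℂ] H) := by
  have hP : ∀ x : ℝ, HasDerivAt (fun y : ℝ => balak (1 / 2) (1 + ((y ^ 2 : ℝ) : ℂ) • R) *
      Ring.inverse (1 + ((y ^ 2 : ℝ) : ℂ) • R))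
      (-(((1 / 2 : ℝ) : ℂ) • (balak (1 / 2) (1 + ((x ^ 2 : ℝ) : ℂ) • R) *
        Ring.inverse (1 + ((x ^ 2 : ℝ) : ℂ) • R) * logDerivPath R x))) x := by
    intro x
    refine ((hR.hasDerivAt_balak_path x).mul
      (hR.hasDerivAt_inverse_one_add_smul x)).congr_deriv ?_
    rw [smul_mul_assoc, mul_assoc, (commute_ringInverse (commute_logDerivPath R x)).eq, mul_neg,
      ← mul_assoc]
    push_cast
    module
  have h := mul_balak_eq_of_path (γ := 1 / 2) (by norm_num) (by norm_num)
    (b := logDerivPath R) zero_le_one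
    (fun x _ => (hR.one_add_smul x).isNonneg)
    (fun x _ => (hasDerivAt_one_add_smul R x).continuousAt.continuousWithinAt)
    (fun x _ => (hP x).continuousAt.continuousWithinAt)
    (fun x _ => hR.eventually_path x) (fun x _ => hR.continuous_logDerivPath.continuousAt)
    (fun x _ => hP x)
  simp only [one_pow, Complex.ofReal_one, one_smul, ne_eq, OfNat.ofNat_ne_zero, not_false_eq_true,
    zero_pow, Complex.ofReal_zero, zero_smul, add_zero, Ring.inverse_one, mul_one] at h
  rw [h, balak_one_eq (by norm_num) (by norm_num), smul_mul_smul, mul_one, sq]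

theorem IsAccretiveCLM.isUnit_balak_one_add {R : H →L[ℂ] H} (hR : IsAccretiveCLM R) :
    IsUnit (balak (1 / 2) (1 + R)) := by
  have h := hR.balak_mul_inverse_mul_balak
  have hc : (balakConst (1 / 2) : ℂ) ^ 2 ≠ 0 :=
    pow_ne_zero 2 (Complex.ofReal_ne_zero.mpr (balakConst_pos (by norm_num) (by norm_num)).ne')
  have hcomm : Commute (Ring.inverse (1 + R)) (balak (1 / 2) (1 + R)) :=
    (isAccretiveCLM_one.add hR).isNonneg.commute_balak (by norm_num) (by norm_num)
      (commute_ringInverse (Commute.refl (1 + R))).symm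
  refine ⟨⟨balak (1 / 2) (1 + R),
    ((balakConst (1 / 2) : ℂ) ^ 2)⁻¹ • (Ring.inverse (1 + R) * balak (1 / 2) (1 + R)),
    ?_, ?_⟩, rfl⟩
  · rw [mul_smul_comm, ← mul_assoc, h, smul_smul, inv_mul_cancel₀ hc, one_smul]
  · rw [hcomm.eq, smul_mul_assoc, h, smul_smul, inv_mul_cancel₀ hc, one_smul]

theorem IsAccretiveCLM.mul_inverse_one_add_smul {R : H →L[ℂ] H} (hR : IsAccretiveCLM R) (x : ℝ) :
    IsAccretiveCLM ((2 : ℂ) • (R * Ring.inverse (1 + ((x ^ 2 : ℝ) : ℂ) • R))) := by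
  have h : IsAccretiveCLM (R * Ring.inverse (1 + ((x ^ 2 : ℝ) : ℂ) • R)) := by
    refine IsAccretiveCLM.mul_inverse (hR.isUnit_one_add_smul x) fun u => ?_
    rw [add_apply, smul_apply, one_apply_eq_self, inner_add_left, inner_smul_left, Complex.add_re,
      Complex.conj_ofReal, Complex.re_ofReal_mul, re_inner_self_eq]
    have := hR u
    positivity
  simpa using h.smul (r := 2) (by norm_num)

theorem IsAccretiveCLM.balak_mul_balak_yosida {R : H →L[ℂ] H} (hR : IsAccretiveCLM R) :
    balak (1 / 2) (1 + R) * balak (1 / 2) (KatoRoot.yosida R) =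
      (balakConst (1 / 2) : ℂ) • balak (1 / 2) ((2 : ℂ) • R) := by
  have ha : ∀ x : ℝ,
      HasDerivAt (fun y : ℝ => (2 : ℂ) • (R * Ring.inverse (1 + ((y ^ 2 : ℝ) : ℂ) • R)))
        ((2 : ℂ) • (R * Ring.inverse (1 + ((x ^ 2 : ℝ) : ℂ) • R)) * -logDerivPath R x) x := by
    intro x
    refine (((hR.hasDerivAt_inverse_one_add_smul x).const_mul R).const_smul (2 : ℂ)).congr_deriv ?_
    rw [smul_mul_assoc, mul_neg, mul_neg, mul_assoc]
  have hcomm : ∀ x : ℝ, Commute (-logDerivPath R x)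
      ((2 : ℂ) • (R * Ring.inverse (1 + ((x ^ 2 : ℝ) : ℂ) • R))) := by
    intro x
    have h : Commute R (logDerivPath R x) :=
      ((Commute.refl R).mul_right (commute_inverse_one_add_smul R _)).smul_right _
    exact ((h.symm.mul_right (commute_ringInverse (commute_logDerivPath R x))).smul_right
      _).neg_left
  have h := mul_balak_eq_of_path (γ := 1 / 2) (by norm_num) (by norm_num)
    (a := fun x : ℝ => (2 : ℂ) • (R * Ring.inverse (1 + ((x ^ 2 : ℝ) : ℂ) • R)))
    (b := fun x => -logDerivPath R x)
    (c := fun x : ℝ => balak (1 / 2) (1 + ((x ^ 2 : ℝ) : ℂ) • R)) zero_le_one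
    (fun x _ => (hR.mul_inverse_one_add_smul x).isNonneg)
    (fun x _ => (ha x).continuousAt.continuousWithinAt)
    (fun x _ => (hR.hasDerivAt_balak_path x).continuousAt.continuousWithinAt)
    (fun x _ => Eventually.of_forall fun y =>
      ⟨(hR.mul_inverse_one_add_smul y).isNonneg, ha y, hcomm y⟩)
    (fun x _ => hR.continuous_logDerivPath.neg.continuousAt)
    (fun x _ => (hR.hasDerivAt_balak_path x).congr_deriv (by rw [mul_neg, smul_neg, neg_neg]))
  simp only [one_pow, Complex.ofReal_one, one_smul, ne_eq, OfNat.ofNat_ne_zero, not_false_eq_true,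
    zero_pow, Complex.ofReal_zero, zero_smul, add_zero, Ring.inverse_one, mul_one] at h
  rw [KatoRoot.yosida, h, balak_one_eq (by norm_num) (by norm_num), smul_mul_assoc, one_mul]

/-- The path `(1 - x²) + x² G` from `1` to `G`. -/
def segPath (G : H →L[ℂ] H) (x : ℝ) : H →L[ℂ] H :=
  ((1 - x ^ 2 : ℝ) : ℂ) • 1 + ((x ^ 2 : ℝ) : ℂ) • G

theorem hasDerivAt_segPath (G : H →L[ℂ] H) (x : ℝ) :
    HasDerivAt (segPath G) (((2 * x : ℝ) : ℂ) • (G - 1)) x := by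
  have h1 := ((hasDerivAt_pow 2 x).ofReal_comp.smul_const G)
  have h2 := (((hasDerivAt_pow 2 x).const_sub 1).ofReal_comp.smul_const (1 : H →L[ℂ] H))
  refine (h2.add h1).congr_deriv ?_
  push_cast
  simp only [pow_one]
  module

theorem IsAccretiveCLM.isUnit_segPath {G : H →L[ℂ] H} (hG : IsAccretiveCLM G) {x : ℝ}
    (hx : x ^ 2 < 1) : IsUnit (segPath G x) := by
  rw [segPath, add_comm]
  exact (hG.smul (sq_nonneg x)).isUnit_add (by linarith)

theorem IsAccretiveCLM.segPath_mul_self {G : H →L[ℂ] H} (hG : IsAccretiveCLM G)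
    (hGG : IsAccretiveCLM (G * G)) {x : ℝ} (hx : x ^ 2 ≤ 1) :
    IsAccretiveCLM ((2 : ℂ) • (segPath G x * segPath G x)) := by
  have h : (2 : ℂ) • (segPath G x * segPath G x) =
      ((2 * (1 - x ^ 2) ^ 2 : ℝ) : ℂ) • 1 + ((4 * (x ^ 2 * (1 - x ^ 2)) : ℝ) : ℂ) • G +
        ((2 * x ^ 4 : ℝ) : ℂ) • (G * G) := by
    simp only [segPath, add_mul, mul_add, smul_mul_smul, one_mul, mul_one]
    push_cast
    module
  rw [h]
  have : 0 ≤ x ^ 2 * (1 - x ^ 2) := mul_nonneg (sq_nonneg x) (by linarith)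
  exact ((isAccretiveCLM_one.smul (by positivity)).add (hG.smul (by linarith))).add
    (hGG.smul (by positivity))

theorem commute_segPath (G : H →L[ℂ] H) (x : ℝ) : Commute (G - 1) (segPath G x) := by
  have h : Commute G (segPath G x) :=
    ((Commute.one_right G).smul_right _).add_right ((Commute.refl G).smul_right _)
  exact h.sub_left (Commute.one_left _)

theorem IsAccretiveCLM.balak_segPath {G : H →L[ℂ] H} (hG : IsAccretiveCLM G)
    (hGG : IsAccretiveCLM (G * G)) {T : ℝ} (hT : 0 ≤ T) (hT1 : T < 1) :
    balak (1 / 2) ((2 : ℂ) • (segPath G T * segPath G T)) =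
      segPath G T * balak (1 / 2) ((2 : ℂ) • 1) := by
  have hx1 : ∀ x ∈ Icc 0 T, x ^ 2 < 1 := fun x hx => by nlinarith [hx.1, hx.2]
  have hinv : ∀ x : ℝ, x ^ 2 < 1 → HasDerivAt (fun y => Ring.inverse (segPath G y))
      (-(Ring.inverse (segPath G x) * (((2 * x : ℝ) : ℂ) • (G - 1)) *
        Ring.inverse (segPath G x))) x := fun x hx =>
    hasDerivAt_ringInverse_comp (hasDerivAt_segPath G x) (hG.isUnit_segPath hx)
  let b : ℝ → H →L[ℂ] H := fun x =>
    ((4 * x : ℝ) : ℂ) • (Ring.inverse (segPath G x) * (G - 1))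
  have hcs : ∀ x, Commute (G - 1) (Ring.inverse (segPath G x)) := fun x =>
    commute_ringInverse (commute_segPath G x)
  have ha : ∀ x : ℝ, x ^ 2 < 1 → HasDerivAt (fun y => (2 : ℂ) • (segPath G y * segPath G y))
      ((2 : ℂ) • (segPath G x * segPath G x) * b x) x := by
    intro x hx
    have hd := hasDerivAt_segPath G x
    refine ((hd.mul hd).const_smul (2 : ℂ)).congr_deriv ?_
    have : segPath G x * segPath G x * (Ring.inverse (segPath G x) * (G - 1)) =
        segPath G x * (G - 1) := by
      rw [mul_assoc, ← mul_assoc (segPath G x) (Ring.inverse _),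
        Ring.mul_inverse_cancel _ (hG.isUnit_segPath hx), one_mul]
    simp only [b]
    rw [smul_mul_smul, this, smul_mul_assoc, mul_smul_comm, (commute_segPath G x).eq]
    push_cast
    module
  have hcomm : ∀ x, Commute (b x) ((2 : ℂ) • (segPath G x * segPath G x)) := by
    intro x
    have h1 : Commute (Ring.inverse (segPath G x) * (G - 1)) (segPath G x) :=
      (commute_ringInverse (Commute.refl _)).symm.mul_left (commute_segPath G x)
    exact ((h1.mul_right h1).smul_right _).smul_left _
  have hsub : ∀ x ∈ Ico 0 T, x ^ 2 < 1 := fun x hx => hx1 x ⟨hx.1, hx.2.le⟩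
  have h := mul_balak_eq_of_path (γ := 1 / 2) (by norm_num) (by norm_num) (b := b)
    (a := fun x => (2 : ℂ) • (segPath G x * segPath G x))
    (c := fun x => Ring.inverse (segPath G x)) hT
    (fun x hx => (hG.segPath_mul_self hGG (hx1 x hx).le).isNonneg)
    (fun x hx => (ha x (hx1 x hx)).continuousAt.continuousWithinAt)
    (fun x hx => (hinv x (hx1 x hx)).continuousAt.continuousWithinAt)
    (fun x hx => ?_) (fun x hx => ?_) (fun x hx => ?_)
  · have h0 : segPath G 0 = 1 := by simp [segPath]
    have hu := hG.isUnit_segPath (hx1 T ⟨hT, le_rfl⟩)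
    simp only [h0, Ring.inverse_one, one_mul] at h
    rw [← h, ← mul_assoc, Ring.mul_inverse_cancel _ hu, one_mul]
  · have : ∀ᶠ y : ℝ in 𝓝 x, y ^ 2 < 1 :=
      ContinuousAt.eventually_lt (by fun_prop) continuousAt_const (hsub x hx)
    filter_upwards [this] with y hy
    exact ⟨(hG.segPath_mul_self hGG hy.le).isNonneg, ha y hy, hcomm y⟩
  · have := (hinv x (hsub x hx)).continuousAt
    simp only [b]
    fun_prop
  · refine (hinv x (hsub x hx)).congr_deriv ?_
    simp only [b]
    rw [mul_assoc, smul_mul_assoc, (hcs x).eq, mul_smul_comm, mul_smul_comm, smul_smul]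
    push_cast
    module

/-- The square root of `2 G²` given by the Balakrishnan integral is a multiple of `G`. -/
theorem IsAccretiveCLM.balak_mul_self {G : H →L[ℂ] H} (hG : IsAccretiveCLM G)
    (hGG : IsAccretiveCLM (G * G)) :
    balak (1 / 2) ((2 : ℂ) • (G * G)) = G * balak (1 / 2) ((2 : ℂ) • (1 : H →L[ℂ] H)) := by
  have hsc : Continuous (segPath G) :=
    continuous_iff_continuousAt.mpr fun x => (hasDerivAt_segPath G x).continuousAt
  have h1 : segPath G 1 = G := by simp [segPath]
  have hle : ∀ x ∈ Icc (0 : ℝ) 1, x ^ 2 ≤ 1 := fun x hx => by nlinarith [hx.1, hx.2]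
  have hc : ContinuousWithinAt
      (fun x => balak (1 / 2) ((2 : ℂ) • (segPath G x * segPath G x))) (Icc 0 1) 1 :=
    continuousWithinAt_balak (by norm_num) (by norm_num) (by simp)
      (fun x hx => (hG.segPath_mul_self hGG (hle x hx)).isNonneg)
      (by fun_prop)
  have hc' : ContinuousWithinAt
      (fun x => segPath G x * balak (1 / 2) ((2 : ℂ) • (1 : H →L[ℂ] H))) (Icc 0 1) 1 := by
    fun_prop
  have hne : (𝓝[Ico (0 : ℝ) 1] 1).NeBot := by
    rw [← mem_closure_iff_nhdsWithin_neBot, closure_Ico zero_ne_one]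
    simp
  have := tendsto_nhds_unique_of_eventuallyEq (hc.mono Ico_subset_Icc_self)
    (hc'.mono Ico_subset_Icc_self) (by
      filter_upwards [self_mem_nhdsWithin] with x hx
      exact hG.balak_segPath hGG hx.1 hx.2)
  simpa only [h1] using this

theorem balak_two_smul_one :
    balak (1 / 2) ((2 : ℂ) • (1 : H →L[ℂ] H)) =
      (balak (1 / 2) (2 : ℂ)) • (1 : H →L[ℂ] H) := by
  have := map_balak (Algebra.ofId ℂ (H →L[ℂ] H)) (continuous_algebraMap ℂ (H →L[ℂ] H))
    (γ := 1 / 2) (by norm_num) (by norm_num) (isNonneg_complex (z := 2) (by simp))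
  rw [Algebra.ofId_apply, Algebra.ofId_apply, Algebra.algebraMap_eq_smul_one,
    Algebra.algebraMap_eq_smul_one] at this
  exact this.symm

theorem balak_half_two_ne_zero : balak (1 / 2) (2 : ℂ) ≠ 0 := by
  have h2 : (2 : ℂ) = Complex.exp (Real.log 2 : ℝ) := by
    rw [← Complex.ofReal_exp, Real.exp_log two_pos]; norm_num
  rw [h2, balak_exp (by norm_num) (by norm_num) (by
    rw [Complex.ofReal_im, abs_zero]; positivity)]
  exact mul_ne_zero (Complex.ofReal_ne_zero.mpr
    (balakConst_pos (by norm_num) (by norm_num)).ne') (Complex.exp_ne_zero _)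

/-- The range of the square root of `2 G² (1 + G²)⁻¹` is the range of `G`. -/
theorem IsAccretiveCLM.range_balak_yosida {G : H →L[ℂ] H} (hG : IsAccretiveCLM G)
    (hGG : IsAccretiveCLM (G * G)) :
    range (balak (1 / 2) (KatoRoot.yosida (G * G)) : H →L[ℂ] H) = range G := by
  have hk := balak_half_two_ne_zero
  have hc : (balakConst (1 / 2) : ℂ) ≠ 0 :=
    Complex.ofReal_ne_zero.mpr (balakConst_pos (by norm_num) (by norm_num)).ne'
  have hu := hGG.isUnit_balak_one_add
  have h := hGG.balak_mul_balak_yosida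
  rw [hG.balak_mul_self hGG, balak_two_smul_one, mul_smul_comm, mul_one, smul_smul] at h
  set N : H →L[ℂ] H := balak (1 / 2) (1 + G * G)
  set k := (balakConst (1 / 2) : ℂ) * balak (1 / 2) (2 : ℂ)
  have hk0 : k ≠ 0 := mul_ne_zero hc hk
  have hcomm : Commute G N :=
    (isAccretiveCLM_one.add hGG).isNonneg.commute_balak (by norm_num) (by norm_num)
      ((Commute.one_right G).add_right ((Commute.refl G).mul_right (Commute.refl G)))
  have hX : balak (1 / 2) (KatoRoot.yosida (G * G)) = G * (k • Ring.inverse N) := by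
    rw [mul_smul_comm, (commute_ringInverse hcomm).eq, ← mul_smul_comm, ← h, ← mul_assoc,
      Ring.inverse_mul_cancel _ hu, one_mul]
  rw [hX]
  ext y
  constructor
  · rintro ⟨u, rfl⟩
    exact ⟨_, rfl⟩
  · rintro ⟨u, rfl⟩
    refine ⟨N (k⁻¹ • u), ?_⟩
    change G (k • Ring.inverse N (N (k⁻¹ • u))) = G u
    rw [ringInverse_apply_self hu, smul_smul, mul_inv_cancel₀ hk0, one_smul]

end Accretive

section InvOp

variable {H : Type*} [NormedAddCommGroup H] [InnerProductSpace ℂ H]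

theorem mem_invOp_domain {R : H →L[ℂ] H} {y : H} : y ∈ (invOp R).domain ↔ ∃ v, R v = y := by
  rw [invOp, LinearPMap.inverse_domain]
  constructor
  · rintro ⟨⟨v, hv⟩, rfl⟩
    exact ⟨v, rfl⟩
  · rintro ⟨v, rfl⟩
    exact ⟨⟨v, trivial⟩, rfl⟩

theorem coe_invOp_domain (R : H →L[ℂ] H) : ((invOp R).domain : Set H) = range R :=
  Set.ext fun _ => mem_invOp_domain

theorem invOp_apply {R : H →L[ℂ] H} (hR : Function.Injective R) {v : H} (u : (invOp R).domain)
    (hu : (u : H) = R v) : invOp R u = v := by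
  have hker : LinearMap.ker ((R : H →ₗ[ℂ] H).toPMap ⊤).toFun = ⊥ := by
    refine LinearMap.ker_eq_bot.mpr fun a b hab => Subtype.ext (hR hab)
  exact LinearPMap.inverse_apply_eq hker (x := ⟨v, trivial⟩) hu.symm

/-- The element `R v` of the domain of the inverse of `R`. -/
def invOpMk (R : H →L[ℂ] H) (v : H) : (invOp R).domain := ⟨R v, mem_invOp_domain.mpr ⟨v, rfl⟩⟩

theorem invOp_invOpMk {R : H →L[ℂ] H} (hR : Function.Injective R) (v : H) :
    invOp R (invOpMk R v) = v :=
  invOp_apply hR _ rfl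

theorem exists_invOpMk (R : H →L[ℂ] H) (u : (invOp R).domain) : ∃ v, u = invOpMk R v := by
  obtain ⟨v, hv⟩ := mem_invOp_domain.mp u.2
  exact ⟨v, Subtype.ext hv.symm⟩

theorem IsResolventAt.unique {A : H →ₗ.[ℂ] H} {ζ : ℂ} {X Y : H →L[ℂ] H}
    (hX : IsResolventAt A ζ X) (hY : IsResolventAt A ζ Y) : X = Y := by
  ext y
  obtain ⟨u, hu, h⟩ := hX.1 y
  rw [← hu, ← hY.2 u, h]

theorem resolventOp_eq {A : H →ₗ.[ℂ] H} {ζ : ℂ} {X : H →L[ℂ] H} (hX : IsResolventAt A ζ X) :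
    resolventOp A ζ = X := by
  have h : ∃ R, IsResolventAt A ζ R := ⟨X, hX⟩
  rw [resolventOp, dif_pos h]
  exact h.choose_spec.unique hX

variable [CompleteSpace H]

theorem isResolventAt_invOp {R : H →L[ℂ] H} (hR : Function.Injective R) {ζ : ℂ}
    (hu : IsUnit (1 - ζ • R)) : IsResolventAt (invOp R) ζ (R * Ring.inverse (1 - ζ • R)) := by
  constructor
  · intro y
    refine ⟨invOpMk R (Ring.inverse (1 - ζ • R) y), rfl, ?_⟩
    rw [invOp_invOpMk hR]
    exact ringInverse_apply_apply hu y
  · intro u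
    obtain ⟨v, rfl⟩ := exists_invOpMk R u
    rw [invOp_invOpMk hR]
    change R (Ring.inverse (1 - ζ • R) ((1 - ζ • R) v)) = R v
    rw [ringInverse_apply_self hu]

theorem isUnit_of_isResolventAt {R : H →L[ℂ] H} (hR : Function.Injective R) {ζ : ℂ}
    {X : H →L[ℂ] H} (hX : IsResolventAt (invOp R) ζ X) : IsUnit (1 - ζ • R) := by
  rw [ContinuousLinearMap.isUnit_iff_bijective]
  constructor
  · refine (injective_iff_map_eq_zero _).mpr fun v hv => ?_
    have h := hX.2 (invOpMk R v)
    rw [invOp_invOpMk hR] at h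
    change X ((1 - ζ • R) v) = R v at h
    rw [hv, map_zero] at h
    exact hR (h.symm.trans (map_zero R).symm)
  · intro y
    obtain ⟨u, -, h⟩ := hX.1 y
    obtain ⟨v, rfl⟩ := exists_invOpMk R u
    rw [invOp_invOpMk hR] at h
    exact ⟨v, h⟩

theorem mem_resolventSet_invOp {R : H →L[ℂ] H} (hR : Function.Injective R) {ζ : ℂ} :
    ζ ∈ resolventSet (invOp R) ↔ IsUnit (1 - ζ • R) :=
  ⟨fun ⟨_, hX⟩ => isUnit_of_isResolventAt hR hX, fun h => ⟨_, isResolventAt_invOp hR h⟩⟩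

theorem resolventOp_invOp {R : H →L[ℂ] H} (hR : Function.Injective R) {ζ : ℂ}
    (hu : IsUnit (1 - ζ • R)) : resolventOp (invOp R) ζ = R * Ring.inverse (1 - ζ • R) :=
  resolventOp_eq (isResolventAt_invOp hR hu)

/-- Inverses of a norm-continuous family of injective operators are norm-resolvent continuous. -/
theorem normResolventContinuousOn_invOp {R : ℝ → H →L[ℂ] H} {s : Set ℝ}
    (hinj : ∀ t ∈ s, Function.Injective (R t)) (hR : ContinuousOn R s) :
    NormResolventContinuousOn (fun t => invOp (R t)) s := by
  intro t₀ ht₀ ζ hζ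
  have hu := (mem_resolventSet_invOp (hinj t₀ ht₀)).mp hζ
  have hc : ContinuousWithinAt (fun t => 1 - ζ • R t) s t₀ :=
    continuousWithinAt_const.sub ((hR t₀ ht₀).const_smul ζ)
  have hev : ∀ᶠ t in 𝓝[s] t₀, IsUnit (1 - ζ • R t) :=
    hc.eventually (Units.isOpen.mem_nhds hu)
  constructor
  · filter_upwards [hev, self_mem_nhdsWithin] with t ht hts
    exact (mem_resolventSet_invOp (hinj t hts)).mpr ht
  · rw [resolventOp_invOp (hinj t₀ ht₀) hu]
    have hinv : ContinuousWithinAt (fun t => Ring.inverse (1 - ζ • R t)) s t₀ := by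
      obtain ⟨u, hu⟩ := hu
      have := NormedRing.inverse_continuousAt u
      rw [hu] at this
      exact ContinuousAt.comp_continuousWithinAt (f := fun t => 1 - ζ • R t) this hc
    refine Tendsto.congr' ?_ ((hR t₀ ht₀).mul hinv)
    filter_upwards [hev, self_mem_nhdsWithin] with t ht hts
    exact (resolventOp_invOp (hinj t hts) ht).symm

theorem cayley_invOp {R : H →L[ℂ] H} (hR : Function.Injective R) (ha : IsAccretiveCLM R) :
    1 + cayley (invOp R) = yosida R := by
  have hu : IsUnit (1 - (-1 : ℂ) • R) := by
    simpa using ha.isUnit_one_add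
  rw [cayley, resolventOp_invOp hR hu, yosida, add_sub_cancel, neg_smul, one_smul, sub_neg_eq_add]

theorem dense_range_of_injective_adjoint {R : H →L[ℂ] H}
    (hR : Function.Injective (ContinuousLinearMap.adjoint R)) : DenseRange R := by
  have h : (LinearMap.range (R : H →ₗ[ℂ] H))ᗮ = ⊥ := by
    have := ContinuousLinearMap.orthogonal_range R
    rw [this]
    exact LinearMap.ker_eq_bot.mpr hR
  have := (Submodule.topologicalClosure_eq_top_iff (K := LinearMap.range (R : H →ₗ[ℂ] H))).mpr h
  rw [Submodule.dense_iff_topologicalClosure_eq_top.symm] at this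
  exact this

theorem adjoint_invOp {R : H →L[ℂ] H} (hR : Function.Injective R)
    (hR' : Function.Injective (ContinuousLinearMap.adjoint R)) :
    (invOp R)† = invOp (ContinuousLinearMap.adjoint R) := by
  have hd : Dense ((invOp R).domain : Set H) := by
    rw [coe_invOp_domain]
    exact dense_range_of_injective_adjoint hR'
  have hdom : ∀ y : (invOp R)†.domain, (y : H) = ContinuousLinearMap.adjoint R ((invOp R)† y) := by
    intro y
    refine ext_inner_right ℂ fun v => ?_
    have h := LinearPMap.adjoint_isFormalAdjoint hd y (invOpMk R v)
    rw [invOp_invOpMk hR] at h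
    rw [ContinuousLinearMap.adjoint_inner_left]
    exact h.symm
  refine LinearPMap.ext (Submodule.ext fun y => ⟨fun hy => ?_, fun hy => ?_⟩) ?_
  · exact mem_invOp_domain.mpr ⟨_, (hdom ⟨y, hy⟩).symm⟩
  · obtain ⟨w, rfl⟩ := mem_invOp_domain.mp hy
    refine LinearPMap.mem_adjoint_domain_of_exists _ ⟨w, fun x => ?_⟩
    obtain ⟨v, rfl⟩ := exists_invOpMk R x
    rw [invOp_invOpMk hR, ContinuousLinearMap.adjoint_inner_left]
    rfl
  · intro y hy hy'
    exact (invOp_apply hR' _ (hdom ⟨y, hy⟩)).symm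

theorem not_isBoundedOp_invOp {R : H →L[ℂ] H} (hR : Function.Injective R)
    (hR' : Function.Injective (ContinuousLinearMap.adjoint R)) (hs : ¬ Function.Surjective R) :
    ¬ IsBoundedOp (invOp R) := by
  rintro ⟨C, hC⟩
  refine hs ?_
  have hb : ∀ v, ‖v‖ ≤ (Real.toNNReal C) * ‖R v‖ := fun v => by
    have := hC (invOpMk R v)
    rw [invOp_invOpMk hR] at this
    exact this.trans (mul_le_mul_of_nonneg_right (Real.le_coe_toNNReal C) (norm_nonneg _))
  have hcl := (R.antilipschitz_of_bound hb).isClosed_range R.uniformContinuous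
  exact range_eq_univ.mp (hcl.closure_eq ▸ (dense_range_of_injective_adjoint hR').closure_range)

theorem abs_arg_le_of_sector {α : ℝ} (h0 : 0 ≤ α) (h1 : α < Real.pi / 2) {z : ℂ}
    (hre : 0 ≤ z.re) (h : Real.cos α * |z.im| ≤ Real.sin α * z.re) : |z.arg| ≤ α := by
  rcases eq_or_ne z 0 with rfl | hz
  · simpa using h0
  have hr : 0 < ‖z‖ := norm_pos_iff.mpr hz
  have hle : |z.arg| ≤ Real.pi / 2 := Complex.abs_arg_le_pi_div_two_iff.mpr hre
  have hpi := Real.pi_pos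
  have hsin : |z.im| = ‖z‖ * Real.sin |z.arg| := by
    rw [← Complex.norm_mul_sin_arg z, abs_mul, abs_of_pos hr,
      Real.abs_sin_eq_sin_abs_of_abs_le_pi (by linarith)]
  have hcos : z.re = ‖z‖ * Real.cos |z.arg| := by
    rw [Real.cos_abs, Complex.norm_mul_cos_arg]
  by_contra! hlt
  have hpos : 0 < Real.sin (|z.arg| - α) := Real.sin_pos_of_pos_of_lt_pi (by linarith) (by linarith)
  rw [hsin, hcos] at h
  rw [Real.sin_sub] at hpos
  nlinarith [mul_pos hr hpos]

/-- `R` is sectorial: accretive with `|Im (Ru, u)| ≤ tan α Re (Ru, u)`. -/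
def IsSectorialCLM (α : ℝ) (R : H →L[ℂ] H) : Prop :=
  ∀ u, 0 ≤ (⟪u, R u⟫_ℂ).re ∧
    Real.cos α * |(⟪u, R u⟫_ℂ).im| ≤ Real.sin α * (⟪u, R u⟫_ℂ).re

theorem isMSectorial_invOp {R : H →L[ℂ] H} (hR : Function.Injective R)
    (hR' : Function.Injective (ContinuousLinearMap.adjoint R)) {α : ℝ} (h0 : 0 ≤ α)
    (h1 : α < Real.pi / 2) (hs : IsSectorialCLM α R) : IsMSectorial α (invOp R) := by
  have ha : IsAccretiveCLM R := fun u => (hs u).1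
  have hz : ∀ z ∈ numericalRange (invOp R),
      0 ≤ z.re ∧ Real.cos α * |z.im| ≤ Real.sin α * z.re := by
    rintro z ⟨u, -, rfl⟩
    obtain ⟨v, rfl⟩ := exists_invOpMk R u
    rw [invOp_invOpMk hR]
    change 0 ≤ (⟪R v, v⟫_ℂ).re ∧ Real.cos α * |(⟪R v, v⟫_ℂ).im| ≤ Real.sin α * (⟪R v, v⟫_ℂ).re
    rw [← inner_conj_symm, Complex.conj_re, Complex.conj_im, abs_neg]
    exact hs v
  refine ⟨⟨h0, h1, fun z h => abs_arg_le_of_sector h0 h1 (hz z h).1 (hz z h).2⟩,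
    fun z h => (hz z h).1, ?_, -1, by simp, fun y => ?_⟩
  · rw [coe_invOp_domain]
    exact dense_range_of_injective_adjoint hR'
  · refine ⟨invOpMk R (Ring.inverse (1 + R) y), ?_⟩
    rw [invOp_invOpMk hR, neg_smul, one_smul, sub_neg_eq_add]
    exact ringInverse_apply_apply ha.isUnit_one_add y

theorem bpow_eq (A : H →L[ℂ] H) (γ : ℝ) :
    bpow A γ = ((Real.sin (γ * Real.pi) / Real.pi : ℝ) : ℂ) • balak γ A := by
  rfl

theorem sin_div_pi_ne_zero {γ : ℝ} (h0 : 0 < γ) (h1 : γ < 1) :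
    ((Real.sin (γ * Real.pi) / Real.pi : ℝ) : ℂ) ≠ 0 := by
  refine Complex.ofReal_ne_zero.mpr (div_pos (Real.sin_pos_of_pos_of_lt_pi ?_ ?_) Real.pi_pos).ne'
  · exact mul_pos h0 Real.pi_pos
  · nlinarith [Real.pi_pos]

theorem coe_fracPow_domain {G : H →L[ℂ] H} (hG : IsAccretiveCLM G) (hGG : IsAccretiveCLM (G * G))
    (hinj : Function.Injective G) :
    ((fracPow (invOp (G * G)) (1 / 2)).domain : Set H) = range G := by
  have hinj2 : Function.Injective (G * G) := hinj.comp hinj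
  change ((invOp (bpow (1 + cayley (invOp (G * G))) (1 / 2))).domain : Set H) = _
  rw [coe_invOp_domain, cayley_invOp hinj2 hGG, ← hG.range_balak_yosida hGG, bpow_eq]
  have hk := sin_div_pi_ne_zero (γ := 1 / 2) (by norm_num) (by norm_num)
  ext y
  constructor
  · rintro ⟨u, rfl⟩
    exact ⟨_, map_smul _ _ u⟩
  · rintro ⟨u, rfl⟩
    refine ⟨((Real.sin (1 / 2 * Real.pi) / Real.pi : ℝ) : ℂ)⁻¹ • u, ?_⟩
    rw [smul_apply, map_smul, smul_smul, mul_inv_cancel₀ hk, one_smul]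

end InvOp

section Core

variable {H : Type*} [NormedAddCommGroup H] [InnerProductSpace ℂ H] [CompleteSpace H]

/-- `Q W` is skew-adjoint. -/
def IsSkew (Q W : H →L[ℂ] H) : Prop := Q * W = -(ContinuousLinearMap.adjoint W * Q)

/-- `W` belongs to the lens class of angle `α`: `‖sin α W ± i cos α‖ ≤ 1`. -/
def IsLens (α : ℝ) (W : H →L[ℂ] H) : Prop :=
  ‖((Real.sin α : ℝ) : ℂ) • W + (Complex.I * (Real.cos α : ℝ)) • 1‖ ≤ 1 ∧
    ‖((Real.sin α : ℝ) : ℂ) • W + (-(Complex.I * (Real.cos α : ℝ))) • 1‖ ≤ 1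

theorem adjoint_smul_add_smul (W : H →L[ℂ] H) (r : ℝ) (c : ℂ) :
    ContinuousLinearMap.adjoint ((r : ℂ) • W + c • 1) =
      (r : ℂ) • ContinuousLinearMap.adjoint W + (starRingEnd ℂ c) • 1 := by
  rw [map_add, map_smulₛₗ, map_smulₛₗ, Complex.conj_ofReal]
  congr 2
  exact star_one _

theorem IsLens.adjoint {α : ℝ} {W : H →L[ℂ] H} (h : IsLens α W) :
    IsLens α (ContinuousLinearMap.adjoint W) := by
  have hn : ∀ T : H →L[ℂ] H, ‖ContinuousLinearMap.adjoint T‖ = ‖T‖ := fun T =>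
    ContinuousLinearMap.adjoint.norm_map T
  constructor
  · rw [← hn, adjoint_smul_add_smul, ContinuousLinearMap.adjoint_adjoint]
    simpa only [map_mul, map_neg, Complex.conj_I, Complex.conj_ofReal, neg_mul, neg_neg] using h.2
  · rw [← hn, adjoint_smul_add_smul, ContinuousLinearMap.adjoint_adjoint]
    simpa only [map_mul, map_neg, Complex.conj_I, Complex.conj_ofReal, neg_mul, neg_neg] using h.1

theorem IsLens.abs_im_le {α : ℝ} (h0 : 0 < α) (h1 : α < Real.pi / 2) {W : H →L[ℂ] H}
    (h : IsLens α W) (v : H) :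
    2 * (Real.cos α * |(⟪v, W v⟫_ℂ).im|) ≤ Real.sin α * (‖v‖ ^ 2 - ‖W v‖ ^ 2) := by
  have hs : 0 < Real.sin α := Real.sin_pos_of_pos_of_lt_pi h0 (by linarith [Real.pi_pos])
  have hc : 0 ≤ Real.cos α := Real.cos_nonneg_of_mem_Icc ⟨by linarith, h1.le⟩
  have key : ∀ ε : ℝ, ε ^ 2 = 1 →
      ‖((Real.sin α : ℝ) : ℂ) • W + ((ε : ℂ) * (Complex.I * (Real.cos α : ℝ))) • 1‖ ≤ 1 →
      2 * (Real.cos α * (ε * (⟪v, W v⟫_ℂ).im)) ≤ Real.sin α * (‖v‖ ^ 2 - ‖W v‖ ^ 2) := by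
    intro ε hε hle
    have h2 := (ContinuousLinearMap.le_of_opNorm_le _ hle v)
    rw [one_mul] at h2
    have h3 := pow_le_pow_left₀ (norm_nonneg _) h2 2
    rw [add_apply, smul_apply, smul_apply, one_apply_eq_self, norm_add_sq (𝕜 := ℂ),
      inner_smul_left, inner_smul_right, norm_smul, norm_smul, ← inner_conj_symm (W v) v] at h3
    simp only [Complex.conj_ofReal, norm_mul, Complex.norm_I, Complex.norm_real, one_mul,
      mul_pow, Real.norm_eq_abs, sq_abs, hε] at h3
    have h4 : RCLike.re (((Real.sin α : ℝ) : ℂ) * ((ε : ℂ) * (Complex.I * (Real.cos α : ℝ)) *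
        (starRingEnd ℂ) ⟪v, W v⟫_ℂ)) = Real.sin α * (ε * (Real.cos α * (⟪v, W v⟫_ℂ).im)) := by
      change Complex.re _ = _
      generalize Real.sin α = s
      generalize Real.cos α = c
      simp only [Complex.re_ofReal_mul, mul_assoc, Complex.I_mul_re, Complex.im_ofReal_mul,
        Complex.conj_im]
      ring
    rw [h4] at h3
    have h5 := Real.sin_sq_add_cos_sq α
    refine le_of_mul_le_mul_left ?_ hs
    nlinarith
  have hp := key 1 (by norm_num) (by simpa using h.1)
  have hm := key (-1) (by norm_num) (by simpa using h.2)
  rcases abs_cases (⟪v, W v⟫_ℂ).im with ⟨h, -⟩ | ⟨h, -⟩ <;> rw [h] <;> linarith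

theorem _root_.ContinuousLinearMap.IsPositive.inner_apply_comm {Q : H →L[ℂ] H} (hQ : Q.IsPositive)
    (u v : H) : ⟪Q u, v⟫_ℂ = ⟪u, Q v⟫_ℂ :=
  hQ.isSymmetric u v

theorem re_inner_eq_zero_imp {Q : H →L[ℂ] H} (hQ : Q.IsPositive) (hQi : Function.Injective Q)
    {u : H} (hu : (⟪u, Q u⟫_ℂ).re = 0) : u = 0 := by
  have h0 : 0 ≤ Q := (ContinuousLinearMap.nonneg_iff_isPositive Q).mpr hQ
  have hsq : CFC.sqrt Q * CFC.sqrt Q = Q := CFC.sqrt_mul_sqrt_self Q h0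
  have hS : (CFC.sqrt Q).IsPositive :=
    (ContinuousLinearMap.nonneg_iff_isPositive _).mp (CFC.sqrt_nonneg Q)
  have h1 : CFC.sqrt Q u = 0 := by
    rw [← hsq] at hu
    change (⟪u, CFC.sqrt Q (CFC.sqrt Q u)⟫_ℂ).re = 0 at hu
    rw [← hS.inner_apply_comm, re_inner_self_eq] at hu
    simpa using hu
  refine hQi ?_
  rw [map_zero, ← hsq]
  change CFC.sqrt Q (CFC.sqrt Q u) = 0
  rw [h1, map_zero]

theorem IsSkew.neg {Q W : H →L[ℂ] H} (h : IsSkew Q W) : IsSkew Q (-W) := by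
  rw [IsSkew, map_neg, mul_neg, h, neg_mul]

theorem IsSkew.re_inner {Q W : H →L[ℂ] H} (hQ : Q.IsPositive) (h : IsSkew Q W) (u : H) :
    (⟪u, (Q * (1 + W)) u⟫_ℂ).re = (⟪u, Q u⟫_ℂ).re := by
  have h1 : (⟪u, (Q * W) u⟫_ℂ).re = 0 := by
    have h2 : ⟪u, (Q * W) u⟫_ℂ = -⟪(Q * W) u, u⟫_ℂ := by
      conv_lhs => rw [h]
      change ⟪u, -(ContinuousLinearMap.adjoint W (Q u))⟫_ℂ = -⟪Q (W u), u⟫_ℂ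
      rw [inner_neg_right, ContinuousLinearMap.adjoint_inner_right,
        ← hQ.inner_apply_comm]
    have h3 := congrArg Complex.re h2
    rw [← inner_conj_symm ((Q * W) u) u, Complex.neg_re, Complex.conj_re] at h3
    linarith
  rw [mul_add, mul_one, add_apply, inner_add_right, Complex.add_re, h1, add_zero]

theorem IsSkew.isAccretiveCLM {Q W : H →L[ℂ] H} (hQ : Q.IsPositive) (h : IsSkew Q W) :
    IsAccretiveCLM (Q * (1 + W)) := fun u => by
  rw [h.re_inner hQ]
  exact hQ.re_inner_nonneg_right u

theorem IsSkew.injective {Q W : H →L[ℂ] H} (hQ : Q.IsPositive) (hQi : Function.Injective Q)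
    (h : IsSkew Q W) : Function.Injective (Q * (1 + W) : H →L[ℂ] H) := by
  refine (injective_iff_map_eq_zero _).mpr fun u hu => re_inner_eq_zero_imp hQ hQi ?_
  rw [← h.re_inner hQ, hu, inner_zero_right, Complex.zero_re]

theorem IsSkew.sandwich_eq {Q W : H →L[ℂ] H} (h : IsSkew Q W) :
    sandwich Q W = Q * (1 + W) * (Q * (1 + W)) := by
  have : (1 - ContinuousLinearMap.adjoint W) * Q = Q * (1 + W) := by
    rw [mul_add, h, sub_mul, mul_one, one_mul, sub_eq_add_neg]
  rw [sandwich, mul_assoc _ _ Q, this]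

theorem IsSkew.adjoint_mul {Q W : H →L[ℂ] H} (hQ : Q.IsPositive) (h : IsSkew Q W) :
    ContinuousLinearMap.adjoint (Q * (1 + W)) = Q * (1 + -W) := by
  change star (Q * (1 + W)) = _
  rw [star_mul, star_add, star_one, hQ.isSelfAdjoint.star_eq, mul_add, mul_neg, h, add_mul,
    neg_neg, one_mul, mul_one]
  rfl

theorem IsSkew.adjoint_sandwich {Q W : H →L[ℂ] H} (hQ : Q.IsPositive) (h : IsSkew Q W) :
    ContinuousLinearMap.adjoint (sandwich Q W) = sandwich Q (-W) := by
  rw [h.sandwich_eq, h.neg.sandwich_eq, ← h.adjoint_mul hQ]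
  exact star_mul _ _

theorem IsSkew.injective_sandwich {Q W : H →L[ℂ] H} (hQ : Q.IsPositive)
    (hQi : Function.Injective Q) (h : IsSkew Q W) : Function.Injective (sandwich Q W) := by
  rw [h.sandwich_eq]
  exact (h.injective hQ hQi).comp (h.injective hQ hQi)

theorem IsSkew.injective_adjoint_sandwich {Q W : H →L[ℂ] H} (hQ : Q.IsPositive)
    (hQi : Function.Injective Q) (h : IsSkew Q W) :
    Function.Injective (ContinuousLinearMap.adjoint (sandwich Q W)) := by
  rw [h.adjoint_sandwich hQ]
  exact h.neg.injective_sandwich hQ hQi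

theorem IsSkew.adjoint_invOp {Q W : H →L[ℂ] H} (hQ : Q.IsPositive)
    (hQi : Function.Injective Q) (h : IsSkew Q W) :
    (invOp (sandwich Q W))† = invOp (sandwich Q (-W)) := by
  rw [KatoRoot.adjoint_invOp (h.injective_sandwich hQ hQi) (h.injective_adjoint_sandwich hQ hQi),
    h.adjoint_sandwich hQ]

theorem isSectorialCLM_sandwich {Q W : H →L[ℂ] H} (hQ : Q.IsPositive) {α : ℝ} (h0 : 0 < α)
    (h1 : α < Real.pi / 2) (hW : IsLens α W) : IsSectorialCLM α (sandwich Q W) := by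
  intro u
  set v := Q u with hv
  set A := ContinuousLinearMap.adjoint W with hA
  have hs : 0 < Real.sin α := Real.sin_pos_of_pos_of_lt_pi h0 (by linarith [Real.pi_pos])
  have hc : 0 ≤ Real.cos α := Real.cos_nonneg_of_mem_Icc ⟨by linarith, h1.le⟩
  have h := hW.adjoint.abs_im_le h0 h1 v
  rw [← hA] at h
  have heq : ⟪u, sandwich Q W u⟫_ℂ =
      ⟪v, v⟫_ℂ - ⟪A v, A v⟫_ℂ + (starRingEnd ℂ ⟪v, A v⟫_ℂ - ⟪v, A v⟫_ℂ) := by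
    change ⟪u, Q ((1 + W) ((1 - A) v))⟫_ℂ = _
    rw [← hQ.inner_apply_comm]
    change ⟪v, (v - A v) + W (v - A v)⟫_ℂ = _
    rw [inner_add_right, ← ContinuousLinearMap.adjoint_inner_left W, ← hA, inner_conj_symm,
      inner_sub_right, inner_sub_right]
    ring
  have hre : (⟪u, sandwich Q W u⟫_ℂ).re = ‖v‖ ^ 2 - ‖A v‖ ^ 2 := by
    rw [heq, Complex.add_re, Complex.sub_re, Complex.sub_re, re_inner_self_eq, re_inner_self_eq,
      Complex.conj_re, sub_self, add_zero]
  have him : (⟪u, sandwich Q W u⟫_ℂ).im = -(2 * (⟪v, A v⟫_ℂ).im) := by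
    have hz : ∀ w : H, (⟪w, w⟫_ℂ).im = 0 := fun w => inner_self_im (𝕜 := ℂ) w
    rw [heq, Complex.add_im, Complex.sub_im, Complex.sub_im, Complex.conj_im, hz, hz]
    ring
  rw [hre, him, abs_neg, abs_mul, abs_two]
  refine ⟨?_, by linarith⟩
  have : 0 ≤ Real.sin α * (‖v‖ ^ 2 - ‖A v‖ ^ 2) := le_trans (by positivity) h
  exact nonneg_of_mul_nonneg_right this hs

theorem not_surjective_sandwich {Q W : H →L[ℂ] H} (hQs : ¬ Function.Surjective Q) :
    ¬ Function.Surjective (sandwich Q W) := fun h => hQs fun y => by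
  obtain ⟨u, hu⟩ := h y
  exact ⟨_, hu⟩

/-- The domains of the square roots of `(Q (1 + W) (1 - W*) Q)⁻¹` and of its adjoint differ as soon
as `1 + W` is not invertible. -/
theorem fracPow_domain_ne {Q W : H →L[ℂ] H} (hQ : Q.IsPositive) (hQi : Function.Injective Q)
    {α : ℝ} (h0 : 0 < α) (h1 : α < Real.pi / 2) (hs : IsSkew Q W) (hW : IsLens α W)
    (hu : ¬ IsUnit (1 + W)) :
    (fracPow (invOp (sandwich Q W)) (1 / 2)).domain ≠
      (fracPow (invOp (sandwich Q W))† (1 / 2)).domain := by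
  have hR : IsAccretiveCLM (Q * (1 + W) * (Q * (1 + W))) := by
    rw [← hs.sandwich_eq]
    exact fun u => (isSectorialCLM_sandwich hQ h0 h1 hW u).1
  have hR' : IsAccretiveCLM (Q * (1 + -W) * (Q * (1 + -W))) := by
    rw [← hs.neg.sandwich_eq, ← hs.adjoint_sandwich hQ, hs.sandwich_eq]
    intro u
    rw [ContinuousLinearMap.adjoint_inner_right, ← inner_conj_symm, Complex.conj_re]
    exact hR u
  intro h
  have h' := congrArg (fun p : Submodule ℂ H => (p : Set H)) h
  simp only [hs.adjoint_invOp hQ hQi] at h'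
  rw [hs.sandwich_eq, hs.neg.sandwich_eq,
    coe_fracPow_domain (hs.isAccretiveCLM hQ) hR (hs.injective hQ hQi),
    coe_fracPow_domain (hs.neg.isAccretiveCLM hQ) hR' (hs.neg.injective hQ hQi)] at h'
  refine hu ((ContinuousLinearMap.isUnit_iff_bijective).mpr ⟨?_, fun y => ?_⟩)
  · exact Function.Injective.of_comp (f := Q) (hs.injective hQ hQi)
  · have hmem : (Q * (1 + -W)) ((2 : ℂ)⁻¹ • y) ∈ range (Q * (1 + W) : H →L[ℂ] H) := by
      rw [h']
      exact ⟨_, rfl⟩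
    obtain ⟨x, hx⟩ := hmem
    have hx' : (1 + W) x = (1 + -W) ((2 : ℂ)⁻¹ • y) := hQi hx
    refine ⟨x + (2 : ℂ)⁻¹ • y, ?_⟩
    rw [map_add, hx']
    change ((2 : ℂ)⁻¹ • y + -(W ((2 : ℂ)⁻¹ • y))) + ((2 : ℂ)⁻¹ • y + W ((2 : ℂ)⁻¹ • y)) = y
    module

/-- The domains of `(Q (1 + W) (1 - W*) Q)⁻¹` and of its adjoint meet only in `0`. -/
theorem domain_inf_adjoint_domain {Q W : H →L[ℂ] H} (hQ : Q.IsPositive)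
    (hQi : Function.Injective Q) (hs : IsSkew Q W) (hWi : Function.Injective W)
    {M : Submodule ℂ H} (hWM : ∀ u, W u ∈ M)
    (hMQ : M ⊓ LinearMap.range (Q : H →ₗ[ℂ] H) = ⊥) :
    (invOp (sandwich Q W)).domain ⊓ (invOp (sandwich Q W))†.domain = ⊥ := by
  rw [hs.adjoint_invOp hQ hQi, Submodule.eq_bot_iff]
  rintro y ⟨h1, h2⟩
  obtain ⟨f, hf⟩ := mem_invOp_domain.mp h1
  obtain ⟨g, hg⟩ := mem_invOp_domain.mp h2
  rw [hs.sandwich_eq] at hf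
  rw [hs.neg.sandwich_eq] at hg
  have hfg : (1 + W) (Q ((1 + W) f)) = (1 + -W) (Q ((1 + -W) g)) := hQi (hf.trans hg.symm)
  set a := (1 + W) f with ha
  set b := (1 + -W) g with hb
  have hfg' : Q a + W (Q a) = Q b + -(W (Q b)) := hfg
  have hsub : Q (a - b) = -W (Q a + Q b) := by
    rw [map_sub, map_add]
    rw [← sub_eq_zero] at hfg' ⊢
    convert! hfg' using 1
    abel
  have hab : a - b = 0 := by
    have hmem : Q (a - b) ∈ M ⊓ LinearMap.range (Q : H →ₗ[ℂ] H) :=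
      ⟨hsub ▸ M.neg_mem (hWM _), ⟨_, rfl⟩⟩
    rw [hMQ, Submodule.mem_bot] at hmem
    exact hQi (hmem.trans (map_zero Q).symm)
  have hQab : Q a + Q b = 0 := by
    rw [hab, map_zero] at hsub
    refine hWi ?_
    rw [map_zero]
    exact neg_eq_zero.mp hsub.symm
  have ha0 : a = 0 := by
    rw [sub_eq_zero] at hab
    rw [← hab, ← two_smul ℂ] at hQab
    refine hQi ?_
    rw [map_zero]
    exact (smul_eq_zero.mp hQab).resolve_left two_ne_zero
  rw [← hf]
  change Q ((1 + W) (Q a)) = 0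
  rw [ha0, map_zero, map_zero, map_zero]

end Core

section Transform

variable {𝔸 𝔹 : Type*} [NormedRing 𝔸] [NormedAlgebra ℂ 𝔸] [CompleteSpace 𝔸]
  [NormedRing 𝔹] [NormedAlgebra ℂ 𝔹] [CompleteSpace 𝔹]

/-- The denominator of the `γ`-transform in a Banach algebra, without its normalising constant. -/
def balakDen (γ : ℝ) (a : 𝔸) : 𝔸 := balak γ (1 + a) + balak γ (1 - a)

/-- The `γ`-transform in a Banach algebra. -/
def balakTransform (γ : ℝ) (a : 𝔸) : 𝔸 :=
  (balak γ (1 + a) - balak γ (1 - a)) * Ring.inverse (balakDen γ a)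

theorem balakDen_neg (γ : ℝ) (a : 𝔸) : balakDen γ (-a) = balakDen γ a := by
  rw [balakDen, balakDen, sub_neg_eq_add, ← sub_eq_add_neg, add_comm]

theorem balakTransform_neg (γ : ℝ) (a : 𝔸) : balakTransform γ (-a) = -balakTransform γ a := by
  rw [balakTransform, balakTransform, balakDen_neg, sub_neg_eq_add, ← sub_eq_add_neg, ← neg_mul,
    neg_sub]

theorem map_balakDen (φ : 𝔸 →ₐ[ℂ] 𝔹) (hφ : Continuous φ) {γ : ℝ} (h0 : 0 < γ) (h1 : γ < 1) {a : 𝔸}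
    (ha : IsNonneg (1 + a)) (ha' : IsNonneg (1 - a)) :
    φ (balakDen γ a) = balakDen γ (φ a) := by
  rw [balakDen, map_add, map_balak φ hφ h0 h1 ha, map_balak φ hφ h0 h1 ha', map_add, map_sub,
    map_one, balakDen]

theorem map_balakTransform (φ : 𝔸 →ₐ[ℂ] 𝔹) (hφ : Continuous φ) {γ : ℝ} (h0 : 0 < γ) (h1 : γ < 1)
    {a : 𝔸} (ha : IsNonneg (1 + a)) (ha' : IsNonneg (1 - a)) (hu : IsUnit (balakDen γ a)) :
    φ (balakTransform γ a) = balakTransform γ (φ a) := by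
  rw [balakTransform, map_mul, map_ringInverse φ hu, map_balakDen φ hφ h0 h1 ha ha', map_sub,
    map_balak φ hφ h0 h1 ha, map_balak φ hφ h0 h1 ha', map_add, map_sub, map_one, balakTransform]

/-- The odd functions `z ↦ z^(2n+1)` and `z ↦ z exp (-t (1 - z²))`. -/
inductive OddSymbol
  | pow (n : ℕ)
  | flow (t : ℝ)

/-- The value of an odd symbol at an element of a Banach algebra. -/
def OddSymbol.eval (s : OddSymbol) (a : 𝔸) : 𝔸 :=
  match s with
  | pow n => a ^ (2 * n + 1)
  | flow t => a * NormedSpace.exp (-(t : ℂ) • (1 - a ^ 2))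

/-- The symbols `z ↦ z^(2n+1)`, and `z ↦ z exp (-t (1 - z²))` for `t ≥ 0`. -/
def OddSymbol.IsAdmissible : OddSymbol → Prop
  | pow _ => True
  | flow t => 0 ≤ t

theorem OddSymbol.eval_neg (s : OddSymbol) (a : 𝔸) : s.eval (-a) = -s.eval a := by
  cases s with
  | pow n => exact Odd.neg_pow ⟨n, rfl⟩ a
  | flow t => simp only [eval, neg_sq, neg_mul]

theorem OddSymbol.map_eval (φ : 𝔸 →ₐ[ℂ] 𝔹) (hφ : Continuous φ) (s : OddSymbol) (a : 𝔸) :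
    φ (s.eval a) = s.eval (φ a) := by
  cases s with
  | pow n => exact map_pow φ a _
  | flow t =>
    simp only [eval]
    rw [map_mul]
    congr 1
    have h1 := (NormedSpace.exp_series_hasSum_exp' (𝕂 := ℂ) (-(t : ℂ) • (1 - a ^ 2))).map φ hφ
    have h2 := NormedSpace.exp_series_hasSum_exp' (𝕂 := ℂ) (-(t : ℂ) • (1 - (φ a) ^ 2))
    refine h1.unique (h2.congr_fun fun n => ?_)
    simp only [Function.comp_apply, map_smul, map_pow, map_sub, map_one]

end Transform

section Lens

/-- The lens of angle `α`, the intersection of two discs whose boundary circles pass through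
`1` and `-1`. -/
def InLens (α : ℝ) (w : ℂ) : Prop :=
  2 * (Real.cos α * |w.im|) ≤ Real.sin α * (1 - ‖w‖ ^ 2)

variable {α : ℝ}

theorem InLens.norm_le_one (h0 : 0 < α) (h1 : α < Real.pi / 2) {w : ℂ} (h : InLens α w) :
    ‖w‖ ≤ 1 := by
  have hs : 0 < Real.sin α := Real.sin_pos_of_pos_of_lt_pi h0 (by linarith [Real.pi_pos])
  have hc : 0 ≤ Real.cos α := Real.cos_nonneg_of_mem_Icc ⟨by linarith, h1.le⟩
  have : 0 ≤ Real.sin α * (1 - ‖w‖ ^ 2) := le_trans (by positivity) h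
  have := nonneg_of_mul_nonneg_right this hs
  nlinarith [norm_nonneg w]

theorem InLens.mul (h0 : 0 < α) (h1 : α < Real.pi / 2) {w z : ℂ} (hw : InLens α w)
    (hz : InLens α z) : InLens α (w * z) := by
  have hs : 0 < Real.sin α := Real.sin_pos_of_pos_of_lt_pi h0 (by linarith [Real.pi_pos])
  have hc : 0 ≤ Real.cos α := Real.cos_nonneg_of_mem_Icc ⟨by linarith, h1.le⟩
  have hx := hw.norm_le_one h0 h1
  have hy := hz.norm_le_one h0 h1
  have hx0 := norm_nonneg w
  have hy0 := norm_nonneg z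
  unfold InLens at *
  rw [norm_mul, Complex.mul_im]
  have him : |w.re * z.im + w.im * z.re| ≤ ‖w‖ * |z.im| + |w.im| * ‖z‖ := by
    refine (abs_add_le _ _).trans ?_
    rw [abs_mul, abs_mul]
    gcongr
    · exact Complex.abs_re_le_norm w
    · exact Complex.abs_re_le_norm z
  have h2 : 0 ≤ (1 - ‖w‖) * (1 - ‖z‖) * (1 - ‖w‖ * ‖z‖) := by
    have : ‖w‖ * ‖z‖ ≤ 1 := mul_le_one₀ hx hy0 hy
    exact mul_nonneg (mul_nonneg (by linarith) (by linarith)) (by linarith)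
  calc _ ≤ 2 * (Real.cos α * (‖w‖ * |z.im| + |w.im| * ‖z‖)) := by gcongr
    _ = ‖w‖ * (2 * (Real.cos α * |z.im|)) + ‖z‖ * (2 * (Real.cos α * |w.im|)) := by ring
    _ ≤ ‖w‖ * (Real.sin α * (1 - ‖z‖ ^ 2)) + ‖z‖ * (Real.sin α * (1 - ‖w‖ ^ 2)) := by gcongr
    _ = Real.sin α * ((1 - (‖w‖ * ‖z‖) ^ 2) - (1 - ‖w‖) * (1 - ‖z‖) * (1 - ‖w‖ * ‖z‖)) := by ring
    _ ≤ _ := mul_le_mul_of_nonneg_left (by linarith) hs.le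

theorem InLens.pow_succ (h0 : 0 < α) (h1 : α < Real.pi / 2) {w : ℂ} (hw : InLens α w) (n : ℕ) :
    InLens α (w ^ (n + 1)) := by
  induction n with
  | zero => simpa using hw
  | succ n ih => rw [_root_.pow_succ]; exact ih.mul h0 h1 hw

theorem inLens_exp (h0 : 0 < α) (h1 : α < Real.pi / 2) {l : ℂ}
    (hl : Real.cos α * |l.im| ≤ Real.sin α * (-l.re)) : InLens α (Complex.exp l) := by
  have hs : 0 < Real.sin α := Real.sin_pos_of_pos_of_lt_pi h0 (by linarith [Real.pi_pos])
  have hc : 0 ≤ Real.cos α := Real.cos_nonneg_of_mem_Icc ⟨by linarith, h1.le⟩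
  have hx : 0 ≤ -l.re := nonneg_of_mul_nonneg_right (le_trans (by positivity) hl) hs
  have hsinh := Real.self_le_sinh_iff.mpr hx
  have hsin : |Real.sin l.im| ≤ |l.im| := Real.abs_sin_le_abs
  have he := Real.exp_pos l.re
  rw [InLens, Complex.exp_im, Complex.norm_exp, abs_mul, abs_of_pos he]
  rw [Real.sinh_eq, neg_neg] at hsinh
  have hee : Real.exp l.re * Real.exp (-l.re) = 1 := by rw [← Real.exp_add]; simp
  calc 2 * (Real.cos α * (Real.exp l.re * |Real.sin l.im|))
      = 2 * Real.exp l.re * (Real.cos α * |Real.sin l.im|) := by ring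
    _ ≤ 2 * Real.exp l.re * (Real.cos α * |l.im|) := by gcongr
    _ ≤ 2 * Real.exp l.re * (Real.sin α * (-l.re)) := by gcongr
    _ ≤ 2 * Real.exp l.re * (Real.sin α * ((Real.exp (-l.re) - Real.exp l.re) / 2)) := by gcongr
    _ = Real.sin α * (Real.exp l.re * Real.exp (-l.re) - Real.exp l.re ^ 2) := by ring
    _ = _ := by rw [hee]

theorem InLens.eval (h0 : 0 < α) (h1 : α < Real.pi / 2) {w : ℂ} (hw : InLens α w) {s : OddSymbol}
    (hs : s.IsAdmissible) : InLens α (s.eval w) := by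
  cases s with
  | pow n => exact hw.pow_succ h0 h1 (2 * n)
  | flow t =>
    have ht : 0 ≤ t := hs
    simp only [OddSymbol.eval, ← Complex.exp_eq_exp_ℂ]
    refine hw.mul h0 h1 (inLens_exp h0 h1 ?_)
    have h2 : InLens α (w ^ 2) := hw.pow_succ h0 h1 1
    have hsin : 0 < Real.sin α := Real.sin_pos_of_pos_of_lt_pi h0 (by linarith [Real.pi_pos])
    have hn := h2.norm_le_one h0 h1
    rw [InLens] at h2
    have hre := Complex.abs_re_le_norm (w ^ 2)
    generalize w ^ 2 = z at *
    have him : (-(t : ℂ) • (1 - z)).im = t * z.im := by simp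
    have hre' : -(-(t : ℂ) • (1 - z)).re = t * (1 - z.re) := by simp
    rw [him, hre', abs_mul, abs_of_nonneg ht]
    have h3 : Real.cos α * |z.im| ≤ Real.sin α * (1 - z.re) := by
      have h4 : 1 - ‖z‖ ^ 2 ≤ 2 * (1 - z.re) := by
        nlinarith [le_abs_self z.re, sq_nonneg (‖z‖ - 1), norm_nonneg z]
      nlinarith [mul_le_mul_of_nonneg_left h4 hsin.le]
    nlinarith [mul_le_mul_of_nonneg_left h3 ht]

theorem eval_ne_zero {w : ℂ} (hw : w ≠ 0) (s : OddSymbol) : s.eval w ≠ 0 := by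
  cases s with
  | pow n => exact pow_ne_zero _ hw
  | flow t =>
    simp only [OddSymbol.eval, ← Complex.exp_eq_exp_ℂ]
    exact mul_ne_zero hw (Complex.exp_ne_zero _)

theorem InLens.norm_le {w : ℂ} (hc : 0 ≤ Real.cos α) (hs : 0 ≤ Real.sin α)
    (hw : InLens α w) {ε : ℝ} (hε : |ε| = 1) :
    ‖((Real.sin α : ℝ) : ℂ) * w + (ε : ℂ) * (Complex.I * (Real.cos α : ℝ))‖ ≤ 1 := by
  have h5 := Real.sin_sq_add_cos_sq α
  rw [← sq_le_one_iff₀ (norm_nonneg _), ← Complex.normSq_eq_norm_sq, Complex.normSq_apply]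
  rw [InLens, ← Complex.normSq_eq_norm_sq, Complex.normSq_apply] at hw
  generalize Real.sin α = s at *
  generalize Real.cos α = c at *
  have hε2 : ε ^ 2 = 1 := by rw [← sq_abs, hε, one_pow]
  have h1 : 2 * (c * (ε * w.im)) ≤ s * (1 - (w.re * w.re + w.im * w.im)) := by
    refine le_trans ?_ hw
    have : ε * w.im ≤ |w.im| := by
      calc ε * w.im ≤ |ε * w.im| := le_abs_self _
        _ = |w.im| := by rw [abs_mul, hε, one_mul]
    gcongr
  simp only [Complex.add_re, Complex.add_im, Complex.re_ofReal_mul, Complex.im_ofReal_mul,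
    Complex.I_mul_re, Complex.I_mul_im, Complex.ofReal_re, Complex.ofReal_im]
  nlinarith [mul_le_mul_of_nonneg_left h1 hs]

end Lens

section Circle

theorem balak_isNonneg_disc {z : ℂ} (hz : ‖z‖ ≤ 1) : IsNonneg (1 + z) ∧ IsNonneg (1 - z) := by
  have h := abs_le.mp ((Complex.abs_re_le_norm z).trans hz)
  exact ⟨isNonneg_complex (by simp; linarith), isNonneg_complex (by simp; linarith)⟩

theorem balak_eq_exp {γ : ℝ} (h0 : 0 < γ) (h1 : γ < 1) {w : ℂ} (hw : 0 < w.re) :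
    balak γ w = balakConst γ * Complex.exp (γ * Complex.log w) := by
  have hw0 : w ≠ 0 := fun h => by simp [h] at hw
  conv_lhs => rw [← Complex.exp_log hw0]
  refine balak_exp h0 h1 ?_
  rw [Complex.log_im]
  exact Complex.abs_arg_lt_pi_div_two_iff.mpr (Or.inl hw)

theorem balak_sector {γ : ℝ} (h0 : 0 < γ) (h1 : γ < 1) {w : ℂ} (hw : 0 < w.re) :
    balak γ w ≠ 0 ∧ Real.cos (Real.pi * γ / 2) * ‖balak γ w‖ ≤ (balak γ w).re := by
  have hk := balakConst_pos h0 h1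
  have harg : |w.arg| < Real.pi / 2 := Complex.abs_arg_lt_pi_div_two_iff.mpr (Or.inl hw)
  have hpi := Real.pi_pos
  rw [balak_eq_exp h0 h1 hw]
  refine ⟨mul_ne_zero (Complex.ofReal_ne_zero.mpr hk.ne') (Complex.exp_ne_zero _), ?_⟩
  rw [norm_mul, Complex.norm_real, Real.norm_of_nonneg hk.le, Complex.norm_exp,
    Complex.re_ofReal_mul _ (Complex.exp _), Complex.exp_re, Complex.im_ofReal_mul, Complex.log_im]
  have hcos : Real.cos (Real.pi * γ / 2) ≤ Real.cos (γ * w.arg) := by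
    rw [← Real.cos_abs (γ * _), abs_mul, abs_of_pos h0]
    refine Real.cos_le_cos_of_nonneg_of_le_pi (by positivity) (by nlinarith) (by nlinarith)
  have he := Real.exp_pos ((γ : ℂ) * Complex.log w).re
  calc _ = balakConst γ * Real.exp ((γ : ℂ) * Complex.log w).re * Real.cos (Real.pi * γ / 2) := by
        ring
    _ ≤ balakConst γ * Real.exp ((γ : ℂ) * Complex.log w).re * Real.cos (γ * w.arg) := by gcongr
    _ = _ := by ring

/-- The values `a`, `b` at `1 + z`, `1 - z`, `‖z‖ = 1`, satisfy `arg (a / b) = ± π γ / 2`. -/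
theorem balak_circle {γ : ℝ} (h0 : 0 < γ) (h1 : γ < 1) {z : ℂ} (hz : ‖z‖ = 1) :
    ∃ E : ℝ, 0 ≤ E ∧
      (balak γ (1 + z) * starRingEnd ℂ (balak γ (1 - z))).re = E * Real.cos (Real.pi * γ / 2) ∧
      |(balak γ (1 + z) * starRingEnd ℂ (balak γ (1 - z))).im| = E * Real.sin (Real.pi * γ / 2) ∧
      balak γ (1 + z) - balak γ (1 - z) ≠ 0 ∧ balakDen γ z ≠ 0 ∧
      Real.cos (Real.pi * γ / 2) * ‖balakDen γ z‖ ≤ (balakDen γ z).re := by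
  have hpi := Real.pi_pos
  have hsq : z.re * z.re + z.im * z.im = 1 := by
    rw [← Complex.normSq_apply, Complex.normSq_eq_norm_sq, hz, one_pow]
  have hzr := abs_le.mp ((Complex.abs_re_le_norm z).trans hz.le)
  rcases eq_or_lt_of_le hzr.2 with h | hlt
  · have : z = 1 := Complex.ext h (by simp; nlinarith)
    have h2 := balak_sector h0 h1 (w := 1 + z) (by simp; linarith)
    subst this
    refine ⟨0, le_rfl, ?_⟩
    simp only [balakDen, sub_self, balak_zero, map_zero, mul_zero, zero_mul, Complex.zero_re,
      Complex.zero_im, abs_zero, sub_zero, add_zero, true_and]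
    exact ⟨h2.1, h2.1, h2.2⟩
  rcases eq_or_lt_of_le hzr.1 with h | hgt
  · have : z = -1 := Complex.ext (by simpa using h.symm) (by simp; nlinarith)
    have h2 := balak_sector h0 h1 (w := 1 - z) (by simp; linarith)
    subst this
    refine ⟨0, le_rfl, ?_⟩
    simp only [balakDen, add_neg_cancel, balak_zero, zero_mul, Complex.zero_re,
      Complex.zero_im, abs_zero, zero_sub, zero_add, true_and, neg_ne_zero]
    exact ⟨h2.1, h2.1, h2.2⟩
  have hp : 0 < (1 + z).re := by simp; linarith
  have hm : 0 < (1 - z).re := by simp; linarith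
  have hp0 : 1 + z ≠ 0 := fun h => by simp [h] at hp
  have hm0 : 1 - z ≠ 0 := fun h => by simp [h] at hm
  have hk := balakConst_pos h0 h1
  have hargp : |(1 + z).arg| < Real.pi / 2 := Complex.abs_arg_lt_pi_div_two_iff.mpr (Or.inl hp)
  have hargm : |(1 - z).arg| < Real.pi / 2 := Complex.abs_arg_lt_pi_div_two_iff.mpr (Or.inl hm)
  set δ := (1 + z).arg - (1 - z).arg with hδ
  have hδpi : |δ| < Real.pi := (abs_sub _ _).trans_lt (by linarith)
  have hexp : Complex.exp (Complex.log (1 + z) + starRingEnd ℂ (Complex.log (1 - z))) =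
      (1 + z) * starRingEnd ℂ (1 - z) := by
    rw [Complex.exp_add, Complex.exp_conj, Complex.exp_log hp0, Complex.exp_log hm0]
  have him : (Complex.log (1 + z) + starRingEnd ℂ (Complex.log (1 - z))).im = δ := by
    rw [Complex.add_im, Complex.conj_im, Complex.log_im, Complex.log_im, hδ, ← sub_eq_add_neg]
  have hcosδ : Real.cos δ = 0 := by
    have h := congrArg Complex.re hexp
    rw [Complex.exp_re, him] at h
    have h3 : ((1 + z) * starRingEnd ℂ (1 - z)).re = 0 := by
      simp [Complex.mul_re]
      linarith
    rw [h3] at h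
    exact (mul_eq_zero.mp h).resolve_left (Real.exp_pos _).ne'
  have hδ2 : |δ| = Real.pi / 2 := by
    refine Real.injOn_cos ⟨abs_nonneg _, hδpi.le⟩ ⟨by positivity, by linarith⟩ ?_
    rw [Real.cos_abs, hcosδ, Real.cos_pi_div_two]
  have hα : |γ * δ| = Real.pi * γ / 2 := by rw [abs_mul, abs_of_pos h0, hδ2]; ring
  have hsin : 0 < Real.sin (Real.pi * γ / 2) :=
    Real.sin_pos_of_pos_of_lt_pi (by positivity) (by nlinarith)
  have hcos : 0 < Real.cos (Real.pi * γ / 2) :=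
    Real.cos_pos_of_mem_Ioo ⟨by nlinarith, by nlinarith⟩
  have hprod : balak γ (1 + z) * starRingEnd ℂ (balak γ (1 - z)) =
      ((balakConst γ ^ 2 : ℝ) : ℂ) *
        Complex.exp (γ * (Complex.log (1 + z) + starRingEnd ℂ (Complex.log (1 - z)))) := by
    rw [balak_eq_exp h0 h1 hp, balak_eq_exp h0 h1 hm, map_mul, ← Complex.exp_conj, map_mul,
      Complex.conj_ofReal, Complex.conj_ofReal, mul_add, Complex.exp_add]
    push_cast
    ring
  have hre : (balak γ (1 + z) * starRingEnd ℂ (balak γ (1 - z))).re =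
      balakConst γ ^ 2 * Real.exp ((γ : ℂ) * (Complex.log (1 + z) +
        starRingEnd ℂ (Complex.log (1 - z)))).re * Real.cos (Real.pi * γ / 2) := by
    rw [hprod, Complex.re_ofReal_mul, Complex.exp_re, Complex.im_ofReal_mul, him, ← Real.cos_abs,
      hα, mul_assoc]
  have himm : |(balak γ (1 + z) * starRingEnd ℂ (balak γ (1 - z))).im| =
      balakConst γ ^ 2 * Real.exp ((γ : ℂ) * (Complex.log (1 + z) +
        starRingEnd ℂ (Complex.log (1 - z)))).re * Real.sin (Real.pi * γ / 2) := by
    rw [hprod, Complex.im_ofReal_mul, Complex.exp_im, Complex.im_ofReal_mul, him, abs_mul, abs_mul,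
      Real.abs_sin_eq_sin_abs_of_abs_le_pi (by rw [hα]; nlinarith), hα, mul_assoc,
      abs_of_pos (Real.exp_pos _), abs_of_nonneg (sq_nonneg _)]
  set E := balakConst γ ^ 2 * Real.exp ((γ : ℂ) * (Complex.log (1 + z) +
    starRingEnd ℂ (Complex.log (1 - z)))).re with hE
  have hEpos : 0 < E := mul_pos (by positivity) (Real.exp_pos _)
  have hsp := balak_sector h0 h1 hp
  have hsm := balak_sector h0 h1 hm
  refine ⟨E, hEpos.le, hre, himm, fun h => ?_, fun h => ?_, ?_⟩
  · rw [sub_eq_zero.mp h, Complex.mul_conj, Complex.ofReal_im, abs_zero] at himm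
    exact (mul_pos hEpos hsin).ne himm
  · have h5 := congrArg Complex.re h
    rw [balakDen, Complex.add_re, Complex.zero_re] at h5
    have h6 : 0 < (balak γ (1 + z)).re :=
      (mul_pos hcos (norm_pos_iff.mpr hsp.1)).trans_le hsp.2
    have h7 : 0 < (balak γ (1 - z)).re :=
      (mul_pos hcos (norm_pos_iff.mpr hsm.1)).trans_le hsm.2
    linarith
  · rw [balakDen, Complex.add_re]
    calc _ ≤ Real.cos (Real.pi * γ / 2) * (‖balak γ (1 + z)‖ + ‖balak γ (1 - z)‖) := by
          gcongr; exact norm_add_le _ _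
      _ ≤ _ := by rw [mul_add]; exact add_le_add hsp.2 hsm.2

theorem inLens_balakTransform {γ : ℝ} (h0 : 0 < γ) (h1 : γ < 1) {z : ℂ} (hz : ‖z‖ = 1) :
    InLens (Real.pi * γ / 2) (balakTransform γ z) ∧ balakTransform γ z ≠ 0 := by
  obtain ⟨E, hE, hre, him, hne, hD, -⟩ := balak_circle h0 h1 hz
  rw [balakTransform, Ring.inverse_eq_inv', ← div_eq_mul_inv]
  refine ⟨?_, div_ne_zero hne hD⟩
  rw [balakDen] at hD ⊢
  generalize balak γ (1 + z) = a at *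
  generalize balak γ (1 - z) = b at *
  have hD2 : 0 < Complex.normSq (a + b) := Complex.normSq_pos.mpr hD
  have h2 : ((a - b) / (a + b)).im * Complex.normSq (a + b) =
      2 * (a * starRingEnd ℂ b).im := by
    rw [Complex.div_im]
    field_simp
    simp
    ring
  have h3 : (1 - ‖(a - b) / (a + b)‖ ^ 2) * Complex.normSq (a + b) =
      4 * (a * starRingEnd ℂ b).re := by
    rw [← Complex.normSq_eq_norm_sq, map_div₀, sub_mul, div_mul_cancel₀ _ hD2.ne',
      Complex.normSq_add, Complex.normSq_sub]
    ring
  rw [InLens]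
  refine le_of_mul_le_mul_right ?_ hD2
  calc _ = 2 * (Real.cos (Real.pi * γ / 2) *
        |((a - b) / (a + b)).im * Complex.normSq (a + b)|) := by
        rw [abs_mul, abs_of_pos hD2]; ring
    _ = 4 * Real.cos (Real.pi * γ / 2) * |(a * starRingEnd ℂ b).im| := by
        rw [h2, abs_mul, abs_two]; ring
    _ = Real.sin (Real.pi * γ / 2) * ((1 - ‖(a - b) / (a + b)‖ ^ 2) * Complex.normSq (a + b)) := by
        rw [h3, him, hre]; ring
    _ ≤ _ := by rw [mul_assoc]

end Circle

section Intertwine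

variable {E F : Type*} [NormedAddCommGroup E] [NormedSpace ℂ E] [CompleteSpace E]
  [NormedAddCommGroup F] [NormedSpace ℂ F] [CompleteSpace F]

/-- `J A = B J`. -/
def Intertwines (J : E →L[ℂ] F) (A : E →L[ℂ] E) (B : F →L[ℂ] F) : Prop := ∀ x, J (A x) = B (J x)

variable {J : E →L[ℂ] F} {A A' : E →L[ℂ] E} {B B' : F →L[ℂ] F}

theorem Intertwines.one : Intertwines J 1 1 := fun _ => rfl

theorem Intertwines.add (h : Intertwines J A B) (h' : Intertwines J A' B') :
    Intertwines J (A + A') (B + B') := fun x => by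
  rw [add_apply, add_apply, map_add, h, h']

theorem Intertwines.sub (h : Intertwines J A B) (h' : Intertwines J A' B') :
    Intertwines J (A - A') (B - B') := fun x => by
  rw [sub_apply, sub_apply, map_sub, h, h']

theorem Intertwines.smul (h : Intertwines J A B) (c : ℂ) : Intertwines J (c • A) (c • B) :=
  fun x => by rw [smul_apply, smul_apply, map_smul, h]

theorem Intertwines.mul (h : Intertwines J A B) (h' : Intertwines J A' B') :
    Intertwines J (A * A') (B * B') := fun x => by
  change J (A (A' x)) = B (B' (J x))
  rw [h, h']

theorem Intertwines.pow (h : Intertwines J A B) (n : ℕ) : Intertwines J (A ^ n) (B ^ n) := by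
  induction n with
  | zero => exact Intertwines.one
  | succ n ih => rw [pow_succ, pow_succ]; exact ih.mul h

theorem Intertwines.inverse (h : Intertwines J A B) (hA : IsUnit A) (hB : IsUnit B) :
    Intertwines J (Ring.inverse A) (Ring.inverse B) := fun x => by
  have h1 : A (Ring.inverse A x) = x := DFunLike.congr_fun (Ring.mul_inverse_cancel A hA) x
  have h2 : Ring.inverse B (B (J (Ring.inverse A x))) = J (Ring.inverse A x) :=
    DFunLike.congr_fun (Ring.inverse_mul_cancel B hB) _
  rw [← h2, ← h, h1]

theorem Intertwines.balak (h : Intertwines J A B) (hA : IsNonneg A) (hB : IsNonneg B) {γ : ℝ}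
    (h0 : 0 < γ) (h1 : γ < 1) : Intertwines J (balak γ A) (balak γ B) := fun x => by
  have hA' := hA.integrableOn_balakIntegrand h0 h1
  have hB' := hB.integrableOn_balakIntegrand h0 h1
  have e1 := (J ∘L ContinuousLinearMap.apply ℂ E x).integral_comp_comm hA'
  have e2 := (ContinuousLinearMap.apply ℂ F (J x)).integral_comp_comm hB'
  refine e1.symm.trans (Eq.trans ?_ e2)
  refine setIntegral_congr_fun measurableSet_Ioi fun t ht => ?_
  have hr : Intertwines J (res A t) (res B t) :=
    (h.add (Intertwines.one.smul _)).inverse (hA.isUnit ht) (hB.isUnit ht)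
  exact ((h.mul hr).smul _) x

theorem Intertwines.exp (h : Intertwines J A B) :
    Intertwines J (NormedSpace.exp A) (NormedSpace.exp B) := fun x => by
  have e1 := (NormedSpace.exp_series_hasSum_exp' (𝕂 := ℂ) A).mapL
    (J ∘L ContinuousLinearMap.apply ℂ E x)
  have e2 := (NormedSpace.exp_series_hasSum_exp' (𝕂 := ℂ) B).mapL
    (ContinuousLinearMap.apply ℂ F (J x))
  refine e1.unique ?_
  convert! e2 using 2 with n
  exact ((h.pow n).smul _) x

theorem Intertwines.balakDen (h : Intertwines J A B) (hA : IsNonneg (1 + A))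
    (hA' : IsNonneg (1 - A)) (hB : IsNonneg (1 + B)) (hB' : IsNonneg (1 - B)) {γ : ℝ}
    (h0 : 0 < γ) (h1 : γ < 1) : Intertwines J (balakDen γ A) (balakDen γ B) :=
  ((Intertwines.one.add h).balak hA hB h0 h1).add ((Intertwines.one.sub h).balak hA' hB' h0 h1)

theorem Intertwines.balakTransform (h : Intertwines J A B) (hA : IsNonneg (1 + A))
    (hA' : IsNonneg (1 - A)) (hB : IsNonneg (1 + B)) (hB' : IsNonneg (1 - B)) {γ : ℝ}
    (h0 : 0 < γ) (h1 : γ < 1) (hAu : IsUnit (KatoRoot.balakDen γ A))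
    (hBu : IsUnit (KatoRoot.balakDen γ B)) :
    Intertwines J (balakTransform γ A) (balakTransform γ B) :=
  (((Intertwines.one.add h).balak hA hB h0 h1).sub
    ((Intertwines.one.sub h).balak hA' hB' h0 h1)).mul
      ((h.balakDen hA hA' hB hB' h0 h1).inverse hAu hBu)

theorem Intertwines.eval (h : Intertwines J A B) (s : OddSymbol) :
    Intertwines J (s.eval A) (s.eval B) := by
  cases s with
  | pow n => exact h.pow _
  | flow t => exact h.mul ((Intertwines.one.sub (h.pow 2)).smul _).exp

theorem Intertwines.norm_le (h : Intertwines J A B) (hJ : ∀ x, ‖J x‖ = ‖x‖) : ‖A‖ ≤ ‖B‖ :=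
  ContinuousLinearMap.opNorm_le_bound _ (norm_nonneg _) fun x => by
    rw [← hJ (A x), h, ← hJ x]
    exact B.le_opNorm _

end Intertwine

section Adjoint

variable {H : Type*} [NormedAddCommGroup H] [InnerProductSpace ℂ H] [CompleteSpace H]

theorem isAccretiveCLM_one_add {Z : H →L[ℂ] H} (hZ : ‖Z‖ ≤ 1) : IsAccretiveCLM (1 + Z) :=
  fun u => by
    have h1 : |(⟪u, Z u⟫_ℂ).re| ≤ ‖u‖ * ‖u‖ :=
      (Complex.abs_re_le_norm _).trans ((norm_inner_le_norm _ _).trans (by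
        gcongr; simpa using Z.le_of_opNorm_le hZ u))
    rw [add_apply, one_apply_eq_self, inner_add_right, Complex.add_re, re_inner_self_eq]
    linarith [neg_abs_le (⟪u, Z u⟫_ℂ).re]

theorem isAccretiveCLM_one_sub {Z : H →L[ℂ] H} (hZ : ‖Z‖ ≤ 1) : IsAccretiveCLM (1 - Z) := by
  rw [sub_eq_add_neg]
  exact isAccretiveCLM_one_add (by rwa [norm_neg])

theorem IsAccretiveCLM.star_balak {A : H →L[ℂ] H} (hA : IsAccretiveCLM A) {γ : ℝ} (h0 : 0 < γ)
    (h1 : γ < 1) : star (balak γ A) = balak γ (star A) := by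
  have hi := hA.isNonneg.integrableOn_balakIntegrand h0 h1
  have e := ((starL' ℝ : (H →L[ℂ] H) ≃L[ℝ] (H →L[ℂ] H)) :
    (H →L[ℂ] H) →L[ℝ] (H →L[ℂ] H)).integral_comp_comm hi
  refine e.symm.trans (setIntegral_congr_fun measurableSet_Ioi fun t ht => ?_)
  change star (balakIntegrand γ A t) = _
  have hr : star (res A t) = res (star A) t := by
    rw [res, res, ← Ring.inverse_star, star_add, star_smul, star_one, Complex.star_def,
      Complex.conj_ofReal]
  rw [balakIntegrand, balakIntegrand, star_smul, star_mul, hr, Complex.star_def,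
    Complex.conj_ofReal, (commute_res (star A) t).eq]

variable {Z : H →L[ℂ] H} {γ : ℝ}

theorem star_balakDen (hZ : ‖Z‖ ≤ 1) (h0 : 0 < γ) (h1 : γ < 1) :
    star (balakDen γ Z) = balakDen γ (star Z) := by
  rw [balakDen, star_add, (isAccretiveCLM_one_add hZ).star_balak h0 h1,
    (isAccretiveCLM_one_sub hZ).star_balak h0 h1, star_add, star_sub, star_one, balakDen]

theorem star_balakTransform (hZ : ‖Z‖ ≤ 1) (h0 : 0 < γ) (h1 : γ < 1) :
    star (balakTransform γ Z) = balakTransform γ (star Z) := by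
  have hc : Commute (balak γ (1 + star Z)) (balak γ (1 - star Z)) := by
    have hZ' : ‖star Z‖ ≤ 1 := by rwa [norm_star]
    have c1 : Commute (1 + star Z) (1 - star Z) :=
      ((Commute.one_left _).add_left ((Commute.one_right _).sub_right (Commute.refl _)))
    exact (isAccretiveCLM_one_sub hZ').isNonneg.commute_balak h0 h1
      ((isAccretiveCLM_one_add hZ').isNonneg.commute_balak h0 h1 c1.symm).symm
  have hc2 : Commute (balak γ (1 + star Z) - balak γ (1 - star Z)) (balakDen γ (star Z)) :=
    ((Commute.refl _).add_right hc).sub_left (hc.symm.add_right (Commute.refl _))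
  rw [balakTransform, star_mul, ← Ring.inverse_star, star_balakDen hZ h0 h1, star_sub,
    (isAccretiveCLM_one_add hZ).star_balak h0 h1, (isAccretiveCLM_one_sub hZ).star_balak h0 h1,
    star_add, star_sub, star_one, ← (commute_ringInverse hc2).eq, balakTransform]

theorem OddSymbol.star_eval (s : OddSymbol) (Z : H →L[ℂ] H) : star (s.eval Z) = s.eval (star Z) := by
  cases s with
  | pow n => exact star_pow _ _
  | flow t =>
    simp only [eval]
    have hc : Commute (star Z) (-(t : ℂ) • (1 - star Z ^ 2)) :=
      ((Commute.one_right _).sub_right ((Commute.refl _).pow_right 2)).smul_right _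
    rw [star_mul, NormedSpace.star_exp, star_smul, star_sub, star_one, star_pow, Complex.star_def,
      map_neg, Complex.conj_ofReal, (hc.exp_right).eq]

theorem isSkew_iff {Q W : H →L[ℂ] H} : IsSkew Q W ↔ Intertwines Q W (-star W) :=
  ⟨fun h x => DFunLike.congr_fun h x, fun h => ContinuousLinearMap.ext h⟩

theorem IsSkew.balakTransform {Q Z : H →L[ℂ] H} (h : IsSkew Q Z) (hZ : ‖Z‖ ≤ 1) (h0 : 0 < γ)
    (h1 : γ < 1) (hu : IsUnit (balakDen γ Z)) : IsSkew Q (balakTransform γ Z) := by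
  have hZ' : ‖-star Z‖ ≤ 1 := by rwa [norm_neg, norm_star]
  rw [isSkew_iff] at *
  rw [star_balakTransform hZ h0 h1, ← balakTransform_neg]
  refine h.balakTransform (isAccretiveCLM_one_add hZ).isNonneg (isAccretiveCLM_one_sub hZ).isNonneg
    (isAccretiveCLM_one_add hZ').isNonneg (isAccretiveCLM_one_sub hZ').isNonneg h0 h1 hu ?_
  rw [balakDen_neg, ← star_balakDen hZ h0 h1]
  exact hu.star

theorem IsSkew.eval {Q Z : H →L[ℂ] H} (h : IsSkew Q Z) (s : OddSymbol) : IsSkew Q (s.eval Z) := by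
  rw [isSkew_iff] at *
  rw [s.star_eval, ← s.eval_neg]
  exact h.eval s

end Adjoint

section Dilation

variable {H : Type*} [NormedAddCommGroup H] [InnerProductSpace ℂ H] [CompleteSpace H]

/-- The embedding `x ↦ (x, 0)` of `H` into `H ⊕ H`. -/
def dilEmb : H →L[ℂ] WithLp 2 (H × H) :=
  (WithLp.prodContinuousLinearEquiv 2 ℂ H H).symm ∘L ContinuousLinearMap.inl ℂ H H

/-- The unitary dilation `(x, y) ↦ (V x + (1 - V V*) y, V* y)` of an isometry `V`. -/
def dilation (V : H →L[ℂ] H) : WithLp 2 (H × H) →L[ℂ] WithLp 2 (H × H) :=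
  (WithLp.prodContinuousLinearEquiv 2 ℂ H H).symm ∘L
    ((V ∘L ContinuousLinearMap.fst ℂ H H + (1 - V * star V) ∘L ContinuousLinearMap.snd ℂ H H).prod
      (star V ∘L ContinuousLinearMap.snd ℂ H H)) ∘L
    (WithLp.prodContinuousLinearEquiv 2 ℂ H H)

/-- The inverse of the unitary dilation. -/
def dilationInv (V : H →L[ℂ] H) : WithLp 2 (H × H) →L[ℂ] WithLp 2 (H × H) :=
  (WithLp.prodContinuousLinearEquiv 2 ℂ H H).symm ∘L
    ((star V ∘L ContinuousLinearMap.fst ℂ H H).prod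
      ((1 - V * star V) ∘L ContinuousLinearMap.fst ℂ H H + V ∘L ContinuousLinearMap.snd ℂ H H)) ∘L
    (WithLp.prodContinuousLinearEquiv 2 ℂ H H)

theorem norm_dilEmb (x : H) : ‖dilEmb x‖ = ‖x‖ := by
  have : ‖dilEmb x‖ ^ 2 = ‖x‖ ^ 2 := by
    rw [← re_inner_self_eq, WithLp.prod_inner_apply]
    change (⟪x, x⟫_ℂ + ⟪(0 : H), 0⟫_ℂ).re = _
    rw [inner_zero_left, add_zero, re_inner_self_eq]
  exact (pow_left_inj₀ (norm_nonneg _) (norm_nonneg _) two_ne_zero).mp this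

theorem intertwines_dilation (V : H →L[ℂ] H) : Intertwines dilEmb V (dilation V) := fun x => by
  change WithLp.toLp 2 (V x, (0 : H)) =
    WithLp.toLp 2 (V x + (0 - V (star V 0)), star V 0)
  simp only [map_zero, sub_zero, add_zero]

theorem star_dilation (V : H →L[ℂ] H) : star (dilation V) = dilationInv V := by
  refine (ContinuousLinearMap.eq_adjoint_iff _ _ |>.mpr fun x y => ?_).symm
  rw [WithLp.prod_inner_apply, WithLp.prod_inner_apply]
  change ⟪star V x.fst, y.fst⟫_ℂ + ⟪(x.fst - V (star V x.fst)) + V x.snd, y.snd⟫_ℂ =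
    ⟪x.fst, V y.fst + (y.snd - V (star V y.snd))⟫_ℂ + ⟪x.snd, star V y.snd⟫_ℂ
  have hA : ∀ a b, ⟪star V a, b⟫_ℂ = ⟪a, V b⟫_ℂ := fun a b =>
    ContinuousLinearMap.adjoint_inner_left V b a
  have hB : ∀ a b, ⟪V a, b⟫_ℂ = ⟪a, star V b⟫_ℂ := fun a b =>
    (ContinuousLinearMap.adjoint_inner_right V a b).symm
  simp only [inner_add_left, inner_add_right, inner_sub_left, inner_sub_right, hA, hB]
  ring

theorem dilation_mem_unitary {V : H →L[ℂ] H} (hV : star V * V = 1) :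
    dilation V ∈ unitary (WithLp 2 (H × H) →L[ℂ] WithLp 2 (H × H)) := by
  have hV' : ∀ x, star V (V x) = x := fun x => DFunLike.congr_fun hV x
  rw [Unitary.mem_iff, star_dilation]
  constructor
  · ext x
    change WithLp.toLp 2 (star V (V x.fst + (x.snd - V (star V x.snd))),
      ((V x.fst + (x.snd - V (star V x.snd))) -
        V (star V (V x.fst + (x.snd - V (star V x.snd))))) + V (star V x.snd)) = x
    simp only [map_add, map_sub, hV', sub_self, add_zero]
    have h : V x.fst + (x.snd - V (star V x.snd)) - V x.fst + V (star V x.snd) = x.snd := by abel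
    rw [h]
    rfl
  · ext x
    change WithLp.toLp 2 (V (star V x.fst) + (((x.fst - V (star V x.fst)) + V x.snd) -
      V (star V ((x.fst - V (star V x.fst)) + V x.snd))),
      star V ((x.fst - V (star V x.fst)) + V x.snd)) = x
    simp only [map_add, map_sub, hV', sub_self, zero_add]
    have h : V (star V x.fst) + (x.fst - V (star V x.fst) + V x.snd - V x.snd) = x.fst := by abel
    rw [h]
    rfl

end Dilation

theorem continuous_algHom_of_norm_eq {𝔸 𝔹 : Type*} [NormedRing 𝔸] [NormedAlgebra ℂ 𝔸]
    [NormedRing 𝔹] [NormedAlgebra ℂ 𝔹] (φ : 𝔸 →ₐ[ℂ] 𝔹) (h : ∀ a, ‖φ a‖ = ‖a‖) : Continuous φ :=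
  (AddMonoidHomClass.isometry_of_norm φ h).continuous

section FunctionAlgebra

variable {X : Type*} [TopologicalSpace X] [CompactSpace X]

theorem isNonneg_continuousMap {f : C(X, ℂ)} (hf : ∀ x, 0 ≤ (f x).re) : IsNonneg f := by
  intro t ht
  have hu : IsUnit (f + (t : ℂ) • 1) := by
    rw [ContinuousMap.isUnit_iff_forall_ne_zero]
    intro x
    exact ((isNonneg_complex (hf x)).isUnit ht).ne_zero
  refine ⟨hu, (ContinuousMap.norm_le _ zero_le_one).mpr fun x => ?_⟩
  have h : (Ring.inverse (f + (t : ℂ) • 1)) x = Ring.inverse (f x + (t : ℂ) • 1) :=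
    map_ringInverse (ContinuousMap.evalAlgHom ℂ ℂ x) hu
  rw [ContinuousMap.smul_apply, h]
  exact (isNonneg_complex (hf x)).norm_smul_res_le ht

variable {f : C(X, ℂ)} (hf : ∀ x, ‖f x‖ = 1) {γ : ℝ} (h0 : 0 < γ) (h1 : γ < 1)
include hf

theorem isNonneg_one_add_of_unimodular : IsNonneg (1 + f) ∧ IsNonneg (1 - f) := by
  have h : ∀ x, -1 ≤ (f x).re ∧ (f x).re ≤ 1 := fun x =>
    abs_le.mp ((Complex.abs_re_le_norm _).trans (hf x).le)
  constructor <;> refine isNonneg_continuousMap fun x => ?_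
  · simp; linarith [(h x).1]
  · simp; linarith [(h x).2]

include h0 h1

theorem balakDen_apply (x : X) : balakDen γ f x = balakDen γ (f x) :=
  map_balakDen (ContinuousMap.evalAlgHom ℂ ℂ x) (continuous_eval_const x) h0 h1
    (isNonneg_one_add_of_unimodular hf).1 (isNonneg_one_add_of_unimodular hf).2

theorem isUnit_balakDen_of_unimodular : IsUnit (balakDen γ f) := by
  rw [ContinuousMap.isUnit_iff_forall_ne_zero]
  intro x
  rw [balakDen_apply hf h0 h1]
  obtain ⟨-, -, -, -, -, h, -⟩ := balak_circle h0 h1 (hf x)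
  exact h

theorem eval_balakTransform_apply (s : OddSymbol) (x : X) :
    s.eval (balakTransform γ f) x = s.eval (balakTransform γ (f x)) := by
  have h := map_balakTransform (ContinuousMap.evalAlgHom ℂ ℂ x)
    (continuous_eval_const x) h0 h1 (isNonneg_one_add_of_unimodular hf).1
    (isNonneg_one_add_of_unimodular hf).2 (isUnit_balakDen_of_unimodular hf h0 h1)
  exact (s.map_eval (ContinuousMap.evalAlgHom ℂ ℂ x)
    (continuous_eval_const x) _).trans (congrArg s.eval h)

theorem isUnit_eval_balakTransform (s : OddSymbol) : IsUnit (s.eval (balakTransform γ f)) := by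
  rw [ContinuousMap.isUnit_iff_forall_ne_zero]
  intro x
  rw [eval_balakTransform_apply hf h0 h1]
  exact eval_ne_zero (inLens_balakTransform h0 h1 (hf x)).2 s

theorem norm_eval_balakTransform_le {s : OddSymbol} (hs : s.IsAdmissible) {ε : ℝ}
    (hε : |ε| = 1) :
    ‖((Real.sin (Real.pi * γ / 2) : ℝ) : ℂ) • s.eval (balakTransform γ f) +
      ((ε : ℂ) * (Complex.I * (Real.cos (Real.pi * γ / 2) : ℝ))) • (1 : C(X, ℂ))‖ ≤ 1 := by
  have hpi := Real.pi_pos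
  refine (ContinuousMap.norm_le _ zero_le_one).mpr fun x => ?_
  rw [ContinuousMap.add_apply, ContinuousMap.smul_apply, ContinuousMap.smul_apply,
    eval_balakTransform_apply hf h0 h1, ContinuousMap.one_apply, smul_eq_mul, smul_eq_mul, mul_one]
  refine InLens.norm_le (Real.cos_nonneg_of_mem_Icc ⟨by nlinarith, by nlinarith⟩)
    (Real.sin_nonneg_of_nonneg_of_le_pi (by positivity) (by nlinarith)) ?_ hε
  exact (inLens_balakTransform h0 h1 (hf x)).1.eval (by positivity) (by nlinarith) hs

/-- A multiple of the denominator is at distance less than `1` from the identity. -/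
theorem exists_norm_one_sub_smul_balakDen_lt :
    ∃ ε : ℝ, 0 < ε ∧ ‖1 - (ε : ℂ) • balakDen γ f‖ < 1 := by
  have hpi := Real.pi_pos
  have hc : 0 < Real.cos (Real.pi * γ / 2) :=
    Real.cos_pos_of_mem_Ioo ⟨by nlinarith, by nlinarith⟩
  set c := Real.cos (Real.pi * γ / 2)
  set ε := c / (‖balakDen γ f‖ + 1)
  have hε : 0 < ε := by positivity
  refine ⟨ε, hε, (ContinuousMap.norm_lt_iff _ one_pos).mpr fun x => ?_⟩
  obtain ⟨-, -, -, -, -, hne, hre⟩ := balak_circle h0 h1 (hf x)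
  rw [← balakDen_apply hf h0 h1] at hne hre
  have hle : ε * ‖balakDen γ f x‖ ≤ c := by
    calc ε * ‖balakDen γ f x‖ ≤ ε * (‖balakDen γ f‖ + 1) := by
          gcongr
          exact (ContinuousMap.norm_coe_le_norm _ x).trans (by linarith)
      _ = c := div_mul_cancel₀ _ (by positivity)
  rw [ContinuousMap.sub_apply, ContinuousMap.smul_apply, ContinuousMap.one_apply, smul_eq_mul]
  generalize balakDen γ f x = D at *
  have hD : 0 < ‖D‖ := norm_pos_iff.mpr hne
  rw [← sq_lt_one_iff₀ (norm_nonneg _), ← Complex.normSq_eq_norm_sq, Complex.normSq_sub,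
    Complex.normSq_one, one_mul, Complex.conj_re, Complex.re_ofReal_mul,
    Complex.normSq_eq_norm_sq, norm_mul, Complex.norm_real, Real.norm_of_nonneg hε.le]
  nlinarith [mul_pos hε hD, mul_le_mul_of_nonneg_left hre hε.le,
    mul_le_mul_of_nonneg_left hle (mul_pos hε hD).le]

end FunctionAlgebra

section Isometry

variable {H : Type*} [NormedAddCommGroup H] [InnerProductSpace ℂ H] [CompleteSpace H]

theorem norm_le_one_of_star_mul_self {E : Type*} [NormedAddCommGroup E] [InnerProductSpace ℂ E]
    [CompleteSpace E] {Z : E →L[ℂ] E} (hZ : star Z * Z = 1) : ‖Z‖ ≤ 1 := by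
  have h := CStarRing.norm_star_mul_self (x := Z)
  rw [hZ] at h
  have h2 : ‖(1 : E →L[ℂ] E)‖ ≤ 1 := ContinuousLinearMap.norm_id_le
  nlinarith [norm_nonneg Z]

variable {Z : H →L[ℂ] H} {γ : ℝ}

/-- For an isometry `Z` the denominator of the `γ`-transform is invertible, and odd functions of the
transform are injective and belong to the lens class. The proof passes to the functional calculus of
a unitary dilation of `Z`. -/
theorem isLens_and_injective_eval_balakTransform {α : ℝ} (hZ : star Z * Z = 1) (h0 : 0 < γ) (h1 : γ < 1)
    (hα : α = Real.pi * γ / 2) :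
    IsUnit (balakDen γ Z) ∧ ∀ s : OddSymbol,
      (s.IsAdmissible → IsLens α (s.eval (balakTransform γ Z))) ∧
      Function.Injective (s.eval (balakTransform γ Z) : H →L[ℂ] H) := by
  subst hα
  set U := dilation Z with hU
  have hmem := dilation_mem_unitary hZ
  have hUn : ‖U‖ ≤ 1 := norm_le_one_of_star_mul_self (Unitary.mem_iff.mp hmem).1
  have hZn : ‖Z‖ ≤ 1 := norm_le_one_of_star_mul_self hZ
  have hnormal : IsStarNormal U := ⟨by
    rw [Commute, SemiconjBy, (Unitary.mem_iff.mp hmem).1, (Unitary.mem_iff.mp hmem).2]⟩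
  let φ : C(spectrum ℂ U, ℂ) →⋆ₐ[ℂ] (WithLp 2 (H × H) →L[ℂ] WithLp 2 (H × H)) :=
    cfcHom (R := ℂ) hnormal
  have hφn : ∀ f, ‖φ f‖ = ‖f‖ := fun f => norm_cfcHom U f hnormal
  have hφc := by
    refine continuous_algHom_of_norm_eq (𝔸 := C(spectrum ℂ U, ℂ))
      (𝔹 := WithLp 2 (H × H) →L[ℂ] WithLp 2 (H × H)) φ.toAlgHom ?_
    exact hφn
  set f : C(spectrum ℂ U, ℂ) := (ContinuousMap.id ℂ).restrict (spectrum ℂ U) with hfdef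
  have hφf : φ f = U := cfcHom_id hnormal
  have hf : ∀ x, ‖f x‖ = 1 := fun x => by
    have h := spectrum.subset_circle_of_unitary hmem x.2
    rwa [mem_sphere_zero_iff_norm] at h
  have hfn := isNonneg_one_add_of_unimodular hf
  have hφd : φ (balakDen γ f) = balakDen γ U := by
    exact (map_balakDen φ.toAlgHom hφc h0 h1 hfn.1 hfn.2).trans (congrArg (balakDen γ) hφf)
  have hdf := isUnit_balakDen_of_unimodular hf h0 h1
  have hφt : φ (balakTransform γ f) = balakTransform γ U := by
    exact (map_balakTransform φ.toAlgHom hφc h0 h1 hfn.1 hfn.2 hdf).trans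
      (congrArg (balakTransform γ) hφf)
  have hφs : ∀ s : OddSymbol, φ (s.eval (balakTransform γ f)) = s.eval (balakTransform γ U) :=
    fun s => by
      have h := s.map_eval (𝔹 := WithLp 2 (H × H) →L[ℂ] WithLp 2 (H × H)) φ.toAlgHom hφc
        (balakTransform γ f)
      exact h.trans (congrArg (fun W => s.eval W) hφt)
  have hJ := intertwines_dilation Z
  rw [← hU] at hJ
  have hZa := (isAccretiveCLM_one_add hZn).isNonneg
  have hZs := (isAccretiveCLM_one_sub hZn).isNonneg
  have hUa := (isAccretiveCLM_one_add hUn).isNonneg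
  have hUs := (isAccretiveCLM_one_sub hUn).isNonneg
  have hJd := hJ.balakDen hZa hZs hUa hUs h0 h1
  have hdZ : IsUnit (balakDen γ Z) := by
    obtain ⟨ε, hε, hlt⟩ := exists_norm_one_sub_smul_balakDen_lt hf h0 h1
    rw [← hφn, map_sub, map_one, map_smul, hφd] at hlt
    have h2 : ‖1 - (ε : ℂ) • balakDen γ Z‖ < 1 :=
      ((Intertwines.one.sub (hJd.smul _)).norm_le norm_dilEmb).trans_lt hlt
    have h3 : IsUnit ((ε : ℂ) • balakDen γ Z) := by
      have := isUnit_one_sub_of_norm_lt_one h2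
      rwa [sub_sub_cancel] at this
    have hε0 : (ε : ℂ) ≠ 0 := Complex.ofReal_ne_zero.mpr hε.ne'
    have h4 := h3.smul (Units.mk0 (ε : ℂ) hε0)⁻¹
    rwa [Units.smul_def, Units.val_inv_eq_inv_val, Units.val_mk0, smul_smul, inv_mul_cancel₀ hε0,
      one_smul] at h4
  have hdU : IsUnit (balakDen γ U) := hφd ▸ hdf.map φ
  have hJt := hJ.balakTransform hZa hZs hUa hUs h0 h1 hdZ hdU
  refine ⟨hdZ, fun s => ⟨fun hs => ?_, ?_⟩⟩
  · have key : ∀ ε : ℝ, |ε| = 1 →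
        ‖((Real.sin (Real.pi * γ / 2) : ℝ) : ℂ) • s.eval (balakTransform γ Z) +
          ((ε : ℂ) * (Complex.I * (Real.cos (Real.pi * γ / 2) : ℝ))) • (1 : H →L[ℂ] H)‖ ≤ 1 := by
      intro ε hε
      have h := norm_eval_balakTransform_le hf h0 h1 hs hε
      rw [← hφn, map_add, map_smul, map_smul, map_one, hφs] at h
      exact ((((hJt.eval s).smul _).add (Intertwines.one.smul _)).norm_le norm_dilEmb).trans h
    exact ⟨by simpa using key 1 (by simp), by simpa using key (-1) (by simp)⟩
  · have hu : IsUnit (s.eval (balakTransform γ U)) :=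
      hφs s ▸ (isUnit_eval_balakTransform hf h0 h1 s).map φ
    have hinj := (ContinuousLinearMap.isUnit_iff_bijective.mp hu).1
    refine (injective_iff_map_eq_zero _).mpr fun x hx => ?_
    have h := hJt.eval s x
    rw [hx, map_zero] at h
    have h2 : dilEmb x = 0 := hinj (h.symm.trans (map_zero _).symm)
    rw [← norm_eq_zero, ← norm_dilEmb, h2, norm_zero]

theorem OddSymbol.continuous_eval (s : OddSymbol) (𝔸 : Type*) [NormedRing 𝔸] [NormedAlgebra ℂ 𝔸]
    [CompleteSpace 𝔸] : Continuous (s.eval : 𝔸 → 𝔸) := by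
  let := NormedAlgebra.restrictScalars ℚ ℂ 𝔸
  cases s with
  | pow n => exact continuous_pow _
  | flow t =>
    exact continuous_id.mul (NormedSpace.exp_continuous.comp
      ((continuous_const.sub (continuous_pow 2)).const_smul _))

theorem balakDen_real_ne_zero {γ : ℝ} (h0 : 0 < γ) (h1 : γ < 1) {r : ℝ} (hr : |r| ≤ 1) :
    balakDen γ (r : ℂ) ≠ 0 := by
  rcases eq_or_lt_of_le hr with h | h
  · obtain ⟨-, -, -, -, -, h, -⟩ := balak_circle h0 h1 (z := (r : ℂ))
      (by rw [Complex.norm_real, Real.norm_eq_abs, h])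
    exact h
  · obtain ⟨hl, hu⟩ := abs_lt.mp h
    have hc : 0 < Real.cos (Real.pi * γ / 2) :=
      Real.cos_pos_of_mem_Ioo ⟨by nlinarith [Real.pi_pos], by nlinarith [Real.pi_pos]⟩
    have key : ∀ w : ℂ, 0 < w.re → 0 < (balak γ w).re := fun w hw =>
      (mul_pos hc (norm_pos_iff.mpr (balak_sector h0 h1 hw).1)).trans_le (balak_sector h0 h1 hw).2
    have h2 := key (1 + (r : ℂ)) (by simp; linarith)
    have h3 := key (1 - (r : ℂ)) (by simp; linarith)
    intro h4
    have h5 := congrArg Complex.re h4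
    rw [balakDen, Complex.add_re, Complex.zero_re] at h5
    linarith

theorem continuousWithinAt_balakTransform_ofReal {γ : ℝ} (h0 : 0 < γ) (h1 : γ < 1) {r : ℝ}
    (hr : r ∈ Icc (-1 : ℝ) 1) :
    ContinuousWithinAt (fun r : ℝ => balakTransform γ (r : ℂ)) (Icc (-1) 1) r := by
  have hp : ContinuousWithinAt (fun r : ℝ => balak γ (1 + (r : ℂ))) (Icc (-1) 1) r :=
    continuousWithinAt_balak h0 h1 hr
      (fun y hy => isNonneg_complex (by simp; linarith [hy.1])) (by fun_prop)
  have hm : ContinuousWithinAt (fun r : ℝ => balak γ (1 - (r : ℂ))) (Icc (-1) 1) r :=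
    continuousWithinAt_balak h0 h1 hr
      (fun y hy => isNonneg_complex (by simp; linarith [hy.2])) (by fun_prop)
  simp only [balakTransform, Ring.inverse_eq_inv']
  exact (hp.sub hm).mul ((hp.add hm).inv₀ (balakDen_real_ne_zero h0 h1 (abs_le.mpr hr)))

theorem balakTransform_ofReal_neg_one {γ : ℝ} (h0 : 0 < γ) (h1 : γ < 1) :
    balakTransform γ (-1 : ℂ) = -1 := by
  have h := balakDen_real_ne_zero h0 h1 (r := -1) (by simp)
  rw [Complex.ofReal_neg, Complex.ofReal_one] at h
  have h2 : balak γ (1 + (-1 : ℂ)) - balak γ (1 - (-1 : ℂ)) = -balakDen γ (-1 : ℂ) := by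
    rw [balakDen, add_neg_cancel, balak_zero]
    ring
  rw [balakTransform, h2, neg_mul, Ring.mul_inverse_cancel _ h.isUnit]

/-- Eigenvectors of `Z*` are eigenvectors of the adjoints of functions of `Z`. -/
theorem star_eval_apply_eigenvector (hZn : ‖Z‖ ≤ 1) (h0 : 0 < γ) (h1 : γ < 1)
    (hu : IsUnit (balakDen γ Z)) {r : ℝ} (hr : |r| ≤ 1) {x : H} (hx : (star Z : H →L[ℂ] H) x = (r : ℂ) • x)
    (s : OddSymbol) :
    (star (s.eval (balakTransform γ Z)) : H →L[ℂ] H) x = s.eval (balakTransform γ (r : ℂ)) • x := by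
  have hsn : ‖star Z‖ ≤ 1 := by rwa [norm_star]
  let A : ℂ →L[ℂ] ℂ := algebraMap ℂ (ℂ →L[ℂ] ℂ) r
  have hA : ‖A‖ ≤ 1 := by
    refine ContinuousLinearMap.opNorm_le_bound _ zero_le_one fun z => ?_
    change ‖(r : ℂ) • z‖ ≤ _
    rw [norm_smul, Complex.norm_real]
    exact mul_le_mul_of_nonneg_right hr (norm_nonneg _)
  have hJ : Intertwines (ContinuousLinearMap.toSpanSingleton ℂ x) A (star Z) := fun z => by
    change ((r : ℂ) • z) • x = star Z (z • x)
    rw [map_smul, hx, smul_smul, smul_eq_mul, mul_comm]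
  have hrn := balak_isNonneg_disc (z := (r : ℂ)) (by rwa [Complex.norm_real])
  have hdr := (balakDen_real_ne_zero h0 h1 hr).isUnit
  have hmapd := map_balakDen (Algebra.ofId ℂ (ℂ →L[ℂ] ℂ)) (continuous_algebraMap ℂ (ℂ →L[ℂ] ℂ)) h0 h1 hrn.1 hrn.2
  have hmapt := map_balakTransform (Algebra.ofId ℂ (ℂ →L[ℂ] ℂ))
    (continuous_algebraMap ℂ (ℂ →L[ℂ] ℂ)) h0 h1 hrn.1 hrn.2 hdr
  have hmaps := s.map_eval (Algebra.ofId ℂ (ℂ →L[ℂ] ℂ))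
    (continuous_algebraMap ℂ (ℂ →L[ℂ] ℂ)) (balakTransform γ (r : ℂ))
  rw [hmapt] at hmaps
  have hdA : IsUnit (balakDen γ A) := hmapd ▸ hdr.map (Algebra.ofId ℂ (ℂ →L[ℂ] ℂ))
  have h := (hJ.balakTransform (isAccretiveCLM_one_add hA).isNonneg
    (isAccretiveCLM_one_sub hA).isNonneg (isAccretiveCLM_one_add hsn).isNonneg
    (isAccretiveCLM_one_sub hsn).isNonneg h0 h1 hdA
    (star_balakDen hZn h0 h1 ▸ hu.star)).eval s 1
  rw [s.star_eval, star_balakTransform hZn h0 h1]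
  have h2 : s.eval (balakTransform γ A) (1 : ℂ) = s.eval (balakTransform γ (r : ℂ)) := by
    have h3 := DFunLike.congr_fun hmaps (1 : ℂ)
    refine h3.symm.trans ?_
    change s.eval (balakTransform γ (r : ℂ)) • (1 : ℂ) = _
    rw [smul_eq_mul, mul_one]
  rw [h2] at h
  simpa using h.symm

theorem star_eval_apply_of_star_apply_eq_zero (hZn : ‖Z‖ ≤ 1) (h0 : 0 < γ) (h1 : γ < 1)
    (hu : IsUnit (balakDen γ Z)) {x : H} (hx : (star Z : H →L[ℂ] H) x = 0) (s : OddSymbol) :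
    (star (s.eval (balakTransform γ Z)) : H →L[ℂ] H) x = 0 := by
  have h := star_eval_apply_eigenvector hZn h0 h1 hu (r := 0) (by simp) (x := x) (by simpa using hx) s
  have ht : balakTransform γ ((0 : ℝ) : ℂ) = 0 := by simp [balakTransform]
  have hs : s.eval (0 : ℂ) = 0 := by cases s <;> simp [OddSymbol.eval]
  rw [h, ht, hs, zero_smul]

theorem not_isUnit_one_add_eval (hZ : star Z * Z = 1) (h0 : 0 < γ) (h1 : γ < 1)
    (hu : IsUnit (balakDen γ Z)) {e : H} (he : e ≠ 0) (hZe : (star Z : H →L[ℂ] H) e = 0) (s : OddSymbol) :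
    ¬ IsUnit (1 + s.eval (balakTransform γ Z)) := by
  intro hW
  have hZn := norm_le_one_of_star_mul_self hZ
  have hW' : IsUnit (1 + star (s.eval (balakTransform γ Z)) : H →L[ℂ] H) := by
    have := hW.star
    rwa [star_add, star_one] at this
  set N := Ring.inverse (1 + star (s.eval (balakTransform γ Z)))
  let ω : ℝ → ℂ := fun r => 1 + s.eval (balakTransform γ ((-r : ℝ) : ℂ))
  have hlow : ∀ r ∈ Ico (0 : ℝ) 1, 1 ≤ ‖N‖ * ‖ω r‖ := by
    intro r hr
    have hrZ : ‖-((r : ℂ) • Z)‖ < 1 := by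
      rw [norm_neg, norm_smul, Complex.norm_real, Real.norm_of_nonneg hr.1]
      nlinarith [hr.1, hr.2, norm_nonneg Z]
    have hur : IsUnit (1 + (r : ℂ) • Z) := by
      have := isUnit_one_sub_of_norm_lt_one hrZ
      rwa [sub_neg_eq_add] at this
    set x := Ring.inverse (1 + (r : ℂ) • Z) e
    have hx : x + (r : ℂ) • Z x = e := ringInverse_apply_apply hur e
    have hx0 : x ≠ 0 := fun h => he (by rw [← hx, h]; simp)
    have hxe : (star Z : H →L[ℂ] H) x = ((-r : ℝ) : ℂ) • x := by
      have h2 := congrArg (star Z : H →L[ℂ] H) hx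
      have h3 : (star Z : H →L[ℂ] H) (Z x) = x := DFunLike.congr_fun hZ x
      rw [hZe, map_add, map_smul, h3] at h2
      rw [Complex.ofReal_neg, neg_smul]
      exact eq_neg_of_add_eq_zero_left h2
    have hr1 : |-r| ≤ 1 := by rw [abs_neg, abs_of_nonneg hr.1]; exact hr.2.le
    have h4 := star_eval_apply_eigenvector hZn h0 h1 hu hr1 hxe s
    have h5 : (1 + star (s.eval (balakTransform γ Z)) : H →L[ℂ] H) x = ω r • x := by
      rw [add_apply, one_apply_eq_self, h4]
      simp only [ω, add_smul, one_smul]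
    have h6 : x = ω r • N x := by
      rw [← map_smul, ← h5, ringInverse_apply_self hW']
    have h7 : ‖x‖ ≤ ‖N‖ * ‖ω r‖ * ‖x‖ := by
      calc ‖x‖ = ‖ω r • N x‖ := congrArg norm h6
        _ = ‖ω r‖ * ‖N x‖ := norm_smul _ _
        _ ≤ ‖ω r‖ * (‖N‖ * ‖x‖) := by gcongr; exact N.le_opNorm x
        _ = _ := by ring
    have hxp : 0 < ‖x‖ := norm_pos_iff.mpr hx0
    by_contra! hlt
    nlinarith
  have hcont : ContinuousWithinAt ω (Icc 0 1) 1 :=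
    continuousWithinAt_const.add ((s.continuous_eval ℂ).continuousAt.comp_continuousWithinAt
      ((continuousWithinAt_balakTransform_ofReal h0 h1 (by simp)).comp
        continuous_neg.continuousWithinAt fun r hr => ⟨by linarith [hr.2], by linarith [hr.1]⟩))
  have hω1 : ω 1 = 0 := by
    have hs : s.eval (-1 : ℂ) = -1 := by
      cases s with
      | pow n => exact Odd.neg_one_pow ⟨n, rfl⟩
      | flow t => simp [OddSymbol.eval]
    simp only [ω, Complex.ofReal_neg, Complex.ofReal_one]
    rw [balakTransform_ofReal_neg_one h0 h1, hs, add_neg_cancel]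
  have hne : (𝓝[Ico (0 : ℝ) 1] 1).NeBot := by
    rw [← mem_closure_iff_nhdsWithin_neBot, closure_Ico zero_ne_one]
    simp
  have hlim : Tendsto (fun r => ‖N‖ * ‖ω r‖) (𝓝[Ico (0 : ℝ) 1] 1) (𝓝 0) := by
    have := ((hcont.mono Ico_subset_Icc_self).norm.tendsto).const_mul ‖N‖
    rwa [hω1, norm_zero, mul_zero] at this
  have := ge_of_tendsto hlim (by
    filter_upwards [self_mem_nhdsWithin] with r hr
    exact hlow r hr)
  linarith

end Isometry

section Construction

variable {H : Type*} [NormedAddCommGroup H] [InnerProductSpace ℂ H] [CompleteSpace H]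

theorem eq_of_mul_eq_mul_of_denseRange {S X Y : H →L[ℂ] H} (hS : DenseRange S)
    (h : X * S = Y * S) : X = Y :=
  DFunLike.coe_injective
    (hS.equalizer X.continuous Y.continuous (funext fun u => DFunLike.congr_fun h u))

theorem norm_apply_eq_of_star_mul_self_eq {A S : H →L[ℂ] H} (h : star A * A = star S * S) (u : H) :
    ‖A u‖ = ‖S u‖ := by
  have key : ∀ T : H →L[ℂ] H, ‖T u‖ ^ 2 = (⟪u, (star T * T) u⟫_ℂ).re := fun T => by
    change _ = (⟪u, ContinuousLinearMap.adjoint T (T u)⟫_ℂ).re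
    rw [ContinuousLinearMap.adjoint_inner_right]
    exact (inner_self_eq_norm_sq (𝕜 := ℂ) (T u)).symm
  have h2 : ‖A u‖ ^ 2 = ‖S u‖ ^ 2 := by rw [key, key, h]
  exact (sq_eq_sq₀ (norm_nonneg _) (norm_nonneg _)).mp h2

theorem exists_isometry_mul_eq {A S : H →L[ℂ] H} (h : star A * A = star S * S)
    (hS : DenseRange S) : ∃ V : H →L[ℂ] H, V * S = A ∧ star V * V = 1 := by
  have hn := norm_apply_eq_of_star_mul_self_eq h
  let V : H →L[ℂ] H := (A : H →ₗ[ℂ] H).extendOfNorm (S : H →ₗ[ℂ] H)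
  have hV : V * S = A := ContinuousLinearMap.ext fun u =>
    LinearMap.extendOfNorm_eq (f := (A : H →ₗ[ℂ] H)) (e := (S : H →ₗ[ℂ] H)) hS
      ⟨1, fun x => by rw [one_mul]; exact (hn x).le⟩ u
  refine ⟨V, hV, eq_of_mul_eq_mul_of_denseRange hS ?_⟩
  rw [one_mul, ← star_inj]
  refine eq_of_mul_eq_mul_of_denseRange hS ?_
  rw [star_mul, star_mul, star_star, ← h, ← hV, star_mul]
  simp only [mul_assoc]

theorem denseRange_of_isSelfAdjoint {S : H →L[ℂ] H} (hS : IsSelfAdjoint S)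
    (hi : Function.Injective S) : DenseRange S :=
  dense_range_of_injective_adjoint (by
    rw [ContinuousLinearMap.isSelfAdjoint_iff'.mp hS]; exact hi)

variable {Q : H →L[ℂ] H} {M : Submodule ℂ H} [M.HasOrthogonalProjection]

/-- The operator `Z₀` is an isometry with range in `M`, and `Q Z₀` is skew-adjoint. -/
theorem Zzero_properties (hQ : Q.IsPositive) (hQi : Function.Injective Q)
    (hMQ : Mᗮ ⊓ LinearMap.range (Q : H →ₗ[ℂ] H) = ⊥) :
    Q * Zzero Q M = Complex.I • rootQPQ Q M ∧ star (Zzero Q M) * Zzero Q M = 1 ∧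
      IsSkew Q (Zzero Q M) ∧ ∀ e ∈ Mᗮ, (star (Zzero Q M) : H →L[ℂ] H) e = 0 := by
  set P := M.starProjection with hP
  set S := rootQPQ Q M with hSdef
  have hPs : star P = P := (isSelfAdjoint_starProjection M).star_eq
  have hPP : P * P = P := (Submodule.isIdempotentElem_starProjection M).eq
  have hQs : star Q = Q := hQ.isSelfAdjoint.star_eq
  have hA : star (P * Q) * (P * Q) = Q * P * Q := by
    rw [star_mul, hPs, hQs, mul_assoc, ← mul_assoc P P Q, hPP, mul_assoc]
  have hSs : star S = S := (CFC.sqrt_nonneg (Q * P * Q)).isSelfAdjoint.star_eq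
  have hSS : star S * S = Q * P * Q := by
    rw [hSs]
    exact CFC.sqrt_mul_sqrt_self _ (hA ▸ star_mul_self_nonneg (P * Q))
  have hAS : star (P * Q) * (P * Q) = star S * S := hA.trans hSS.symm
  have hSi : Function.Injective S := by
    refine (injective_iff_map_eq_zero _).mpr fun u hu => ?_
    have h1 : P (Q u) = 0 := by
      have := norm_apply_eq_of_star_mul_self_eq hAS u
      rw [hu, norm_zero, norm_eq_zero] at this
      exact this
    have h2 : Q u ∈ Mᗮ := (Submodule.starProjection_apply_eq_zero_iff M).mp h1
    have h3 : Q u ∈ (⊥ : Submodule ℂ H) := hMQ ▸ ⟨h2, u, rfl⟩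
    exact hQi (((Submodule.mem_bot ℂ).mp h3).trans (map_zero Q).symm)
  have hSd : DenseRange S := denseRange_of_isSelfAdjoint hSs hSi
  obtain ⟨V, hVS, hVV⟩ := exists_isometry_mul_eq hAS hSd
  have hPV : P * V = V := eq_of_mul_eq_mul_of_denseRange hSd (by
    rw [mul_assoc, hVS, ← mul_assoc, hPP])
  have hQV : Q * V = S := by
    have h1 : S = star V * (P * Q) := by rw [← hVS, ← mul_assoc, hVV, one_mul]
    have h2 := congrArg star h1
    rw [hSs, star_mul, star_mul, star_star, hPs, hQs, mul_assoc, hPV] at h2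
    exact h2.symm
  have hex : ∃ Z : H →L[ℂ] H, Q * Z = Complex.I • S :=
    ⟨Complex.I • V, by rw [mul_smul_comm, hQV]⟩
  have hZ : Zzero Q M = hex.choose := dif_pos hex
  have hQZ : Q * Zzero Q M = Complex.I • S := hZ ▸ hex.choose_spec
  have hZV : Zzero Q M = Complex.I • V := by
    ext u
    refine hQi ?_
    have h : Q * Zzero Q M = Q * (Complex.I • V) := by rw [hQZ, mul_smul_comm, hQV]
    exact DFunLike.congr_fun h u
  have hstar : star (Complex.I • V) = (-Complex.I) • star V := by
    rw [star_smul]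
    congr 1
    exact Complex.conj_I
  refine ⟨hQZ, ?_, ?_, fun e he => ?_⟩
  · rw [hZV, hstar, smul_mul_smul_comm, hVV, neg_mul, Complex.I_mul_I, neg_neg, one_smul]
  · have h := congrArg star hQZ
    rw [star_mul, hQs, star_smul, hSs] at h
    change _ = -(star _ * Q)
    rw [h, hQZ, ← neg_smul]
    congr 1
    exact (neg_eq_iff_eq_neg.mpr Complex.conj_I).symm
  · have h1 : P e = 0 := (Submodule.starProjection_apply_eq_zero_iff M).mpr he
    have h2 : star V = star V * P := by
      conv_lhs => rw [← hPV, star_mul, hPs]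
    rw [hZV, hstar, h2]
    change (-Complex.I) • (star V : H →L[ℂ] H) (P e) = 0
    rw [h1, map_zero, smul_zero]

variable {Z : H →L[ℂ] H} {γ : ℝ}

theorem transformDenom_eq (Z : H →L[ℂ] H) (γ : ℝ) :
    transformDenom Z γ = ((Real.sin (γ * Real.pi) / Real.pi : ℝ) : ℂ) • balakDen γ Z := by
  rw [transformDenom, bpow_eq, bpow_eq, balakDen, smul_add]

theorem isUnit_transformDenom (h0 : 0 < γ) (h1 : γ < 1) (hu : IsUnit (balakDen γ Z)) :
    IsUnit (transformDenom Z γ) := by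
  rw [transformDenom_eq]
  exact (isUnit_smul_iff (Units.mk0 _ (sin_div_pi_ne_zero h0 h1)) _).mpr hu

theorem transform_eq (h0 : 0 < γ) (h1 : γ < 1) (hu : IsUnit (balakDen γ Z)) :
    transform Z γ = balakTransform γ Z := by
  have hT := isUnit_transformDenom h0 h1 hu
  refine hT.mul_right_cancel ?_
  rw [transform, mul_assoc, Ring.inverse_mul_cancel _ hT, mul_one, transformDenom_eq,
    balakTransform, mul_smul_comm, mul_assoc, Ring.inverse_mul_cancel _ hu, mul_one, bpow_eq,
    bpow_eq, smul_sub]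

theorem continuous_sandwich_flow (Q Z : H →L[ℂ] H) : Continuous fun t => sandwich Q (flow Z t) := by
  let := NormedAlgebra.restrictScalars ℚ ℂ (H →L[ℂ] H)
  have hf : Continuous fun t : ℝ => flow Z t :=
    continuous_const.mul (NormedSpace.exp_continuous.comp
      ((Complex.continuous_ofReal.neg).smul continuous_const))
  exact ((continuous_const.mul (continuous_const.add hf)).mul
    (continuous_const.sub (continuous_star.comp hf))).mul continuous_const

end Construction

end

end KatoRoot

theorem mainTheorem6 {H : Type*} [NormedAddCommGroup H] [InnerProductSpace ℂ H] [CompleteSpace H]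
    [TopologicalSpace.SeparableSpace H]
    (Q : H →L[ℂ] H) (hQpos : Q.IsPositive)
    (hQker : LinearMap.ker (Q : H →ₗ[ℂ] H) = ⊥) (hQran : LinearMap.range (Q : H →ₗ[ℂ] H) ≠ ⊤)
    (M : Submodule ℂ H) [M.HasOrthogonalProjection] (hM : M ≠ ⊤)
    (hMQ : Mᗮ ⊓ LinearMap.range (Q : H →ₗ[ℂ] H) = ⊥) :
    -- `Z₀ = i Q⁻¹ (Q P_M Q)^(1/2)` is a well-defined contraction
    (Q * KatoRoot.Zzero Q M = Complex.I • KatoRoot.rootQPQ Q M ∧ ‖KatoRoot.Zzero Q M‖ ≤ 1) ∧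
    ∀ γ : ℝ, 0 < γ → γ < 1 →
      -- the inverses that define `Z_γ^(0)`, `B_{γ,n}` and `S_γ(t)` exist
      IsUnit (KatoRoot.transformDenom (KatoRoot.Zzero Q M) γ) ∧
      (∀ n : ℕ, Function.Injective
        (KatoRoot.sandwich Q (KatoRoot.Zgamma Q M γ ^ (2 * n + 1)))) ∧
      (∀ t : ℝ, 0 ≤ t → Function.Injective
        (KatoRoot.sandwich Q (KatoRoot.flow (KatoRoot.Zgamma Q M γ) t))) ∧
      -- the operators are unbounded and `m`-`πγ/2`-sectorial
      (∀ n : ℕ, ¬ KatoRoot.IsBoundedOp (KatoRoot.opB Q M γ n) ∧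
        KatoRoot.IsMSectorial (Real.pi * γ / 2) (KatoRoot.opB Q M γ n)) ∧
      (∀ t : ℝ, 0 ≤ t → ¬ KatoRoot.IsBoundedOp (KatoRoot.opS Q M γ t) ∧
        KatoRoot.IsMSectorial (Real.pi * γ / 2) (KatoRoot.opS Q M γ t)) ∧
      -- norm-resolvent continuity on `[0, ∞)`
      KatoRoot.NormResolventContinuousOn (KatoRoot.opS Q M γ) (Set.Ici 0) ∧
      -- the domains of the square roots of the operator and of its adjoint differ
      (∀ n : ℕ, (KatoRoot.fracPow (KatoRoot.opB Q M γ n) (1 / 2)).domain ≠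
        (KatoRoot.fracPow (KatoRoot.opB Q M γ n)† (1 / 2)).domain) ∧
      (∀ t : ℝ, 0 ≤ t → (KatoRoot.fracPow (KatoRoot.opS Q M γ t) (1 / 2)).domain ≠
        (KatoRoot.fracPow (KatoRoot.opS Q M γ t)† (1 / 2)).domain) ∧
      -- the domains of the operator and of its adjoint may meet only in `0`
      (M ⊓ LinearMap.range (Q : H →ₗ[ℂ] H) = ⊥ →
        (∀ n : ℕ, (KatoRoot.opB Q M γ n).domain ⊓ (KatoRoot.opB Q M γ n)†.domain = ⊥) ∧
        (∀ t : ℝ, 0 ≤ t →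
          (KatoRoot.opS Q M γ t).domain ⊓ (KatoRoot.opS Q M γ t)†.domain = ⊥)) := by
  have hQi : Function.Injective Q := LinearMap.ker_eq_bot.mp hQker
  have hQs : ¬ Function.Surjective Q := fun h => hQran (LinearMap.range_eq_top.mpr h)
  obtain ⟨hQZ, hZ, hskew, hZe⟩ := KatoRoot.Zzero_properties hQpos hQi hMQ
  have hZn := KatoRoot.norm_le_one_of_star_mul_self hZ
  obtain ⟨e, heM, he0⟩ : ∃ e ∈ Mᗮ, e ≠ 0 := by
    refine Submodule.exists_mem_ne_zero_of_ne_bot fun h => hM ?_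
    rwa [Submodule.orthogonal_eq_bot_iff] at h
  refine ⟨⟨hQZ, hZn⟩, fun γ h0 h1 => ?_⟩
  have hpi := Real.pi_pos
  have hα0 : 0 < Real.pi * γ / 2 := by positivity
  have hα1 : Real.pi * γ / 2 < Real.pi / 2 := by nlinarith
  obtain ⟨hu, hspec⟩ := KatoRoot.isLens_and_injective_eval_balakTransform hZ h0 h1 rfl
  have hT : KatoRoot.Zgamma Q M γ = KatoRoot.balakTransform γ (KatoRoot.Zzero Q M) :=
    KatoRoot.transform_eq h0 h1 hu
  have hsk := fun s : KatoRoot.OddSymbol => (hskew.balakTransform hZn h0 h1 hu).eval s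
  have hinj := fun s => (hsk s).injective_sandwich hQpos hQi
  have hinj' := fun s => (hsk s).injective_adjoint_sandwich hQpos hQi
  have hsect := fun (s : KatoRoot.OddSymbol) (hs : s.IsAdmissible) =>
    And.intro
      (KatoRoot.not_isBoundedOp_invOp (hinj s) (hinj' s) (KatoRoot.not_surjective_sandwich hQs))
      (KatoRoot.isMSectorial_invOp (hinj s) (hinj' s) hα0.le hα1
        (KatoRoot.isSectorialCLM_sandwich hQpos hα0 hα1 ((hspec s).1 hs)))
  have hroot := fun (s : KatoRoot.OddSymbol) (hs : s.IsAdmissible) =>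
    KatoRoot.fracPow_domain_ne hQpos hQi hα0 hα1 (hsk s) ((hspec s).1 hs)
      (KatoRoot.not_isUnit_one_add_eval hZ h0 h1 hu he0 (hZe e heM) s)
  have hdom := fun (s : KatoRoot.OddSymbol) (h : M ⊓ LinearMap.range (Q : H →ₗ[ℂ] H) = ⊥) =>
    KatoRoot.domain_inf_adjoint_domain hQpos hQi (hsk s) (hspec s).2 (fun u => by
      refine M.orthogonal_orthogonal.le ((Submodule.mem_orthogonal _ _).mpr fun x hx => ?_)
      rw [← ContinuousLinearMap.adjoint_inner_left]
      have h2 := KatoRoot.star_eval_apply_of_star_apply_eq_zero hZn h0 h1 hu (hZe x hx) s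
      rw [ContinuousLinearMap.star_eq_adjoint] at h2
      rw [h2, inner_zero_left]) h
  have hres : KatoRoot.NormResolventContinuousOn (KatoRoot.opS Q M γ) (Set.Ici 0) :=
    KatoRoot.normResolventContinuousOn_invOp (fun t _ => by rw [hT]; exact hinj (.flow t))
      (KatoRoot.continuous_sandwich_flow _ _).continuousOn
  refine ⟨KatoRoot.isUnit_transformDenom h0 h1 hu, ?_, ?_, ?_, ?_, hres, ?_⟩
  all_goals simp only [KatoRoot.opB, KatoRoot.opS, hT]
  · exact fun n => hinj (.pow n)
  · exact fun t _ => hinj (.flow t)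
  · exact fun n => hsect (.pow n) trivial
  · exact fun t ht => hsect (.flow t) ht
  · exact ⟨fun n => hroot (.pow n) trivial, fun t ht => hroot (.flow t) ht,
      fun h => ⟨fun n => hdom (.pow n) h, fun t _ => hdom (.flow t) h⟩⟩
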